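/- Let $m,N\in\mathbb{N}$ be positive with $N+1\ge m$, let $a<b$ be real, and put $h=\frac{b-a}{N}$. Let $L_2^{(m)}[a,b]$ be the space of complex-valued functions on $[a,b]$ whose $(m-1)$-th derivative is absolutely continuous and whose $m$-th derivative is square integrable, with $\|\varphi\|=\left(\int_a^b|\varphi^{(m)}(x)|^2\,dx\right)^{1/2}$. Coefficients $C_0,\dots,C_N\in\mathbb{C}$ of the quadrature formula $$\int_a^b\varphi(x)\,dx\cong\sum_{\beta=0}^N C_\beta\,\varphi(h\beta+a)$$ are called optimal in the sense of Sard if the error functional $(\ell,\varphi)=\int_a^b\varphi(x)\,dx-\sum_{\beta=0}^N C_\beta\varphi(h\beta+a)$ is bounded on $L_2^{(m)}[a,b]$, i.e. $\|\ell\|=\sup_{\|\varphi\|\le 1}|(\ell,\varphi)|<\infty$, and $\|\ell\|$ is minimal among all choices of the coefficients. Let $E_k(x)=\frac{(1-x)^{k+2}}{x}\left(x\frac{d}{dx}\right)^k\frac{x}{(1-x)^2}$ be the Euler--Frobenius polynomials, let $\Delta^i0^j=\sum_{l=1}^i(-1)^{i-l}\binom{i}{l}l^j$, and let $B_n$ be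 the Bernoulli numbers. The polynomial $E_{2m-2}$ has exactly $m-1$ complex roots of modulus less than $1$; they are real, and we denote them by $q_1<\dots<q_{m-1}$. The linear system $$\sum_{k=1}^{m-1}d_k\sum_{i=1}^j\frac{q_k+(-1)^{i+1}q_k^{N+i}}{(q_k-1)^{i+1}}\,\Delta^i0^j=\frac{B_{j+1}}{j+1},\qquad j=1,\dots,m-1,$$ has a real solution $(d_1,\dots,d_{m-1})$. For each real solution, there is exactly one choice of coefficients that is optimal in the sense of Sard, namely $$C_0=C_N=h\left(\frac12-\sum_{k=1}^{m-1}d_k\frac{q_k-q_k^N}{1-q_k}\right),\qquad C_\beta=h\left(1+\sum_{k=1}^{m-1}d_k\left(q_k^\beta+q_k^{N-\beta}\right)\right),\quad \beta=1,\dots,N-1.$$ -/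

import Mathlib

open MeasureTheory Set

open scoped ENNReal

namespace SardQuadrature

/-- The Sobolev space `L₂^{(m)}[a,b]` (`m ≥ 1`) of complex-valued functions whose `(m-1)`-th
derivative on `[a,b]` exists and is absolutely continuous and whose `m`-th derivative (which then
exists almost everywhere) is square integrable. Only the values of `φ` on `[a,b]` matter;
derivatives are taken within `[a,b]`, so they are one-sided at the end points. -/
structure MemSobolev (m : ℕ) (a b : ℝ) (φ : ℝ → ℂ) : Prop where
  contDiffOn : ContDiffOn ℝ ((m - 1 : ℕ) : WithTop ℕ∞) φ (Icc a b)
  absolutelyContinuous :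
    AbsolutelyContinuousOnInterval (iteratedDerivWithin (m - 1) φ (Icc a b)) a b
  memLp : MemLp (iteratedDerivWithin m φ (Icc a b)) 2 (volume.restrict (Icc a b))

/-- The norm `‖φ‖ = (∫_a^b |φ^{(m)}(x)|² dx)^{1/2}` of `L₂^{(m)}[a,b]`. It vanishes exactly on the
polynomials of degree less than `m` (on `[a,b]`). -/
noncomputable def sobolevNorm (m : ℕ) (a b : ℝ) (φ : ℝ → ℂ) : ℝ :=
  Real.sqrt (∫ x in a..b, ‖iteratedDerivWithin m φ (Icc a b) x‖ ^ 2)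

/-- The value `(ℓ, φ) = ∫_a^b φ(x) dx - ∑_{β=0}^N C_β φ(hβ + a)`, `h = (b - a) / N`, of the error
functional of the quadrature formula with coefficients `C` and equally spaced nodes. -/
noncomputable def quadratureError {N : ℕ} (a b : ℝ) (C : Fin (N + 1) → ℂ) (φ : ℝ → ℂ) : ℂ :=
  (∫ x in a..b, φ x) - ∑ β : Fin (N + 1), C β * φ ((b - a) / N * (β : ℝ) + a)

/-- The norm `‖ℓ‖` of the error functional in the dual of `L₂^{(m)}[a,b]`, that is, the supremum of
`|(ℓ, φ)|` over all `φ` in the space with `‖φ‖ ≤ 1`. It is `∞` if `ℓ` does not belong to the dual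
space, in particular if `ℓ` does not vanish on all polynomials of degree less than `m`. -/
noncomputable def errorNorm {N : ℕ} (m : ℕ) (a b : ℝ) (C : Fin (N + 1) → ℂ) : ℝ≥0∞ :=
  ⨆ (φ : ℝ → ℂ) (_ : MemSobolev m a b φ) (_ : sobolevNorm m a b φ ≤ 1),
    ‖quadratureError a b C φ‖ₑ

/-- The coefficients `C` are optimal in the sense of Sard: the error functional belongs to the dual
of `L₂^{(m)}[a,b]`, and its norm is the least possible one over all choices of the coefficients. -/
structure IsSardOptimal {N : ℕ} (m : ℕ) (a b : ℝ) (C : Fin (N + 1) → ℂ) : Prop where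
  mem_dual : errorNorm m a b C ≠ ∞
  norm_eq_iInf : errorNorm m a b C = ⨅ C' : Fin (N + 1) → ℂ, errorNorm m a b C'

/-- The Euler-Frobenius polynomials, by the recurrence that results from carrying out one
differentiation in
`E_k(x) = (1 - x)^{k+2} / x * (x d/dx)^k (x / (1 - x)^2)`; see `eulerFrobenius_eval`. -/
noncomputable def eulerFrobenius : ℕ → Polynomial ℝ
  | 0 => 1
  | k + 1 =>
    (1 + Polynomial.C ((k : ℝ) + 1) * Polynomial.X) * eulerFrobenius k
      + Polynomial.X * (1 - Polynomial.X) * Polynomial.derivative (eulerFrobenius k)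

theorem iterate_eval (k : ℕ) : ∀ x : ℝ, x ≠ 1 →
    ((fun (f : ℝ → ℝ) (y : ℝ) => y * deriv f y)^[k] (fun y => y / (1 - y) ^ 2)) x
      = x * (eulerFrobenius k).eval x / (1 - x) ^ (k + 2) := by
  induction k with
  | zero => intro x _; simp [eulerFrobenius]
  | succ k ih =>
    intro x hx
    have hx' : (1 - x) ≠ 0 := sub_ne_zero.mpr (Ne.symm hx)
    rw [Function.iterate_succ_apply']
    have hev : ((fun (f : ℝ → ℝ) (y : ℝ) => y * deriv f y)^[k] (fun y => y / (1 - y) ^ 2))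
        =ᶠ[nhds x] fun y => y * (eulerFrobenius k).eval y / (1 - y) ^ (k + 2) := by
      filter_upwards [isOpen_ne.mem_nhds hx] with y hy using ih y hy
    have hd : HasDerivAt (fun y : ℝ => y * (eulerFrobenius k).eval y / (1 - y) ^ (k + 2))
        (((1 * (eulerFrobenius k).eval x + x * (eulerFrobenius k).derivative.eval x)
            * (1 - x) ^ (k + 2)
          - x * (eulerFrobenius k).eval x * (((k + 2 : ℕ) : ℝ) * (1 - x) ^ (k + 2 - 1) * (-1)))
          / ((1 - x) ^ (k + 2)) ^ 2) x := by
      have h1 := (hasDerivAt_id x).mul ((eulerFrobenius k).hasDerivAt x)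
      have h2 : HasDerivAt (fun y : ℝ => (1 - y) ^ (k + 2))
          (((k + 2 : ℕ) : ℝ) * (1 - x) ^ (k + 2 - 1) * (-1)) x :=
        ((hasDerivAt_id x).const_sub 1).pow (k + 2)
      exact h1.div h2 (pow_ne_zero _ hx')
    show x * deriv _ x = _
    rw [hev.deriv_eq, hd.deriv]
    simp only [eulerFrobenius, Polynomial.eval_add, Polynomial.eval_mul, Polynomial.eval_sub,
      Polynomial.eval_one, Polynomial.eval_X, Polynomial.eval_C]
    rw [show k + 2 - 1 = k + 1 from rfl]
    push_cast
    field_simp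
    ring

/-- `E_k(x) = (1 - x)^{k+2} / x * (x d/dx)^k (x / (1 - x)^2)` wherever the right-hand side makes
sense, which determines the polynomial `E_k`. -/
theorem eulerFrobenius_eval (k : ℕ) (x : ℝ) (hx0 : x ≠ 0) (hx1 : x ≠ 1) :
    (eulerFrobenius k).eval x = (1 - x) ^ (k + 2) / x *
      ((fun (f : ℝ → ℝ) (y : ℝ) => y * deriv f y)^[k] (fun y => y / (1 - y) ^ 2)) x := by
  have hx' : (1 - x) ≠ 0 := sub_ne_zero.mpr (Ne.symm hx1)
  rw [iterate_eval k x hx1]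
  field_simp

/-- The finite differences of powers at zero, `Δ^i 0^j = ∑_{l=1}^i (-1)^{i-l} (i choose l) l^j`. -/
noncomputable def diffZeroPow (i j : ℕ) : ℝ :=
  ∑ l ∈ Finset.Icc 1 i, (-1) ^ (i - l) * (i.choose l : ℝ) * (l : ℝ) ^ j

/-- The `m - 1` numbers `q` enumerate increasingly the complex roots of the Euler-Frobenius
polynomial `E_{2m-2}` of modulus less than one (in particular, all those roots are real). -/
def IsRootEnumeration (m : ℕ) (q : Fin (m - 1) → ℝ) : Prop :=
  StrictMono q ∧
    ∀ z : ℂ, (Polynomial.aeval z (eulerFrobenius (2 * m - 2)) = 0 ∧ ‖z‖ < 1) ↔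
      ∃ k, z = ((q k : ℝ) : ℂ)

/-- The linear system
`∑_k d_k ∑_{i=1}^j (q_k + (-1)^{i+1} q_k^{N+i}) / (q_k - 1)^{i+1} Δ^i 0^j = B_{j+1} / (j + 1)`,
`j = 1, …, m - 1`, for the numbers `d_k`. -/
def SolvesSystem (m N : ℕ) (q d : Fin (m - 1) → ℝ) : Prop :=
  ∀ j ∈ Finset.Icc 1 (m - 1),
    ∑ k, d k * ∑ i ∈ Finset.Icc 1 j,
        (q k + (-1) ^ (i + 1) * q k ^ (N + i)) / (q k - 1) ^ (i + 1) * diffZeroPow i j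
      = ((bernoulli (j + 1) : ℚ) : ℝ) / ((j : ℝ) + 1)

/-- The explicit coefficients: `h (1/2 - ∑_k d_k (q_k - q_k^N) / (1 - q_k))` for `β = 0` and
`β = N`, and `h (1 + ∑_k d_k (q_k^β + q_k^{N-β}))` for `0 < β < N`, with `h = (b - a) / N`. -/
noncomputable def explicitCoeff {m : ℕ} (N : ℕ) (a b : ℝ) (q d : Fin (m - 1) → ℝ)
    (β : Fin (N + 1)) : ℝ :=
  if β = 0 ∨ β = Fin.last N then
    (b - a) / N * (1 / 2 - ∑ k, d k * ((q k - q k ^ N) / (1 - q k)))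
  else
    (b - a) / N * (1 + ∑ k, d k * (q k ^ (β : ℕ) + q k ^ (N - (β : ℕ))))

end SardQuadrature

namespace SardQuadrature

/-! ### Absolutely continuous complex-valued functions -/

/-! Optimality is a duality argument. If a formula is exact in degree less than `m`, repeated
integration by parts represents its error as `(-1)^m ∫ S^(m) φ^(m)`, where `S` is a spline whose
jumps are the coefficients (`functional_eq_integral`). Cauchy-Schwarz bounds the norm by `σ`, the
`L²` norm of `S^(m)`. If moreover `S` vanishes at the nodes, every formula takes the same value `±
σ²` at `S`, whose norm is `σ`; so no formula has norm below `σ`. A formula of norm `σ` must agree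
with the given one in all directions, by perturbing `S` (`eq_zero_of_quadratic_bound`); cardinal
polynomials then identify each coefficient. This is `isSardOptimal_iff`.

It remains to find coefficients with these two properties. The sums `∑ C_γ (β - γ)^n` have a closed
form in the polynomials `A_j` that continue `∑ l^j λ^l` (`sum_geom_mul_pow`,
`sum_unitCoeff_mul_pow`). For `n = 2m - 1` the geometric terms in `β` disappear because `q_k` is a
root of `E_{2m-2}`, that is, `A_{2m-1}(1/(1 - q_k)) = 0`. The end coefficients cancel the term
`β^(2m-1)`, and the linear system cancels the powers from `m` to `2m - 2`. What is left is `β^(2m) /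
(2m)` plus a polynomial of degree less than `m`, so the spline vanishes at the nodes
(`spline_vanish_unit`). The case `β = N`, `n < m` gives exactness (`moment_unitCoeff`).

For solvability, the same formulas are used with `κ = 0`. A solution of the homogeneous system
yields a natural spline that is zero at its knots, hence has no jumps; its polynomial part then has
too many zeros. So weighted sums of `A_j(u_k)` and `A_j(1 - u_k)`, `u_k = 1/(1 - q_k)`, vanish for
all `1 ≤ j ≤ 2m - 2`, and a Vandermonde argument forces `d = 0`. The roots themselves come from
Rolle's theorem and the symmetry `u ↦ 1 - u`, which corresponds to `x ↦ 1/x`. -/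

theorem absolutelyContinuous_of_dist_le {X Y : Type*} [PseudoMetricSpace X] [PseudoMetricSpace Y]
    {f : ℝ → X} {g : ℝ → Y} {a b : ℝ} (hf : AbsolutelyContinuousOnInterval f a b)
    (h : ∀ x y, dist (g x) (g y) ≤ dist (f x) (f y)) : AbsolutelyContinuousOnInterval g a b := by
  rw [absolutelyContinuousOnInterval_iff] at hf ⊢
  intro ε hε
  obtain ⟨δ, hδ, H⟩ := hf ε hε
  exact ⟨δ, hδ, fun E hE hs => (Finset.sum_le_sum fun i _ => h _ _).trans_lt (H E hE hs)⟩

theorem absolutelyContinuous_re {f : ℝ → ℂ} {a b : ℝ} (hf : AbsolutelyContinuousOnInterval f a b) :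
    AbsolutelyContinuousOnInterval (fun x => (f x).re) a b :=
  absolutelyContinuous_of_dist_le hf fun x y => by
    simpa [dist_eq_norm] using Complex.abs_re_le_norm (f x - f y)

theorem absolutelyContinuous_im {f : ℝ → ℂ} {a b : ℝ} (hf : AbsolutelyContinuousOnInterval f a b) :
    AbsolutelyContinuousOnInterval (fun x => (f x).im) a b :=
  absolutelyContinuous_of_dist_le hf fun x y => by
    simpa [dist_eq_norm] using Complex.abs_im_le_norm (f x - f y)

theorem absolutelyContinuous_ofReal {f : ℝ → ℝ} {a b : ℝ}
    (hf : AbsolutelyContinuousOnInterval f a b) :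
    AbsolutelyContinuousOnInterval (fun x => (f x : ℂ)) a b :=
  absolutelyContinuous_of_dist_le hf fun x y => by
    simp [dist_eq_norm, ← Complex.ofReal_sub]

theorem integral_of_ae_hasDerivAt_real {f f' : ℝ → ℝ} {a b : ℝ} (hab : a ≤ b)
    (hf : AbsolutelyContinuousOnInterval f a b)
    (h : ∀ᵐ x, x ∈ Icc a b → HasDerivAt f (f' x) x) :
    IntervalIntegrable f' volume a b ∧ ∫ x in a..b, f' x = f b - f a := by
  have key : ∀ᵐ x, x ∈ uIoc a b → deriv f x = f' x := by
    filter_upwards [h] with x hx hxm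
    rw [uIoc_of_le hab] at hxm
    exact (hx (Ioc_subset_Icc_self hxm)).deriv
  refine ⟨hf.intervalIntegrable_deriv.congr_ae ?_, ?_⟩
  · exact (ae_restrict_iff' measurableSet_uIoc).2 key
  · rw [← hf.integral_deriv_eq_sub]
    exact intervalIntegral.integral_congr_ae (key.mono fun x hx hm => (hx hm).symm)

theorem integral_of_ae_hasDerivAt {f f' : ℝ → ℂ} {a b : ℝ} (hab : a ≤ b)
    (hf : AbsolutelyContinuousOnInterval f a b)
    (h : ∀ᵐ x, x ∈ Icc a b → HasDerivAt f (f' x) x) :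
    IntervalIntegrable f' volume a b ∧ ∫ x in a..b, f' x = f b - f a := by
  obtain ⟨i1, e1⟩ := integral_of_ae_hasDerivAt_real (f' := fun x => (f' x).re) hab
    (absolutelyContinuous_re hf)
    (h.mono fun x hx hm => Complex.reCLM.hasFDerivAt.comp_hasDerivAt x (hx hm))
  obtain ⟨i2, e2⟩ := integral_of_ae_hasDerivAt_real (f' := fun x => (f' x).im) hab
    (absolutelyContinuous_im hf)
    (h.mono fun x hx hm => Complex.imCLM.hasFDerivAt.comp_hasDerivAt x (hx hm))
  have e : f' = fun x => (((f' x).re : ℝ) : ℂ) + (((f' x).im : ℝ) : ℂ) * Complex.I := by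
    funext x; exact (Complex.re_add_im _).symm
  have i1' : IntervalIntegrable (fun x => (((f' x).re : ℝ) : ℂ)) volume a b :=
    ⟨i1.1.ofReal, i1.2.ofReal⟩
  have i2' : IntervalIntegrable (fun x => (((f' x).im : ℝ) : ℂ)) volume a b :=
    ⟨i2.1.ofReal, i2.2.ofReal⟩
  rw [e]
  refine ⟨i1'.add (i2'.mul_const _), ?_⟩
  rw [intervalIntegral.integral_add i1' (i2'.mul_const _), intervalIntegral.integral_mul_const,
    intervalIntegral.integral_ofReal, intervalIntegral.integral_ofReal, e1, e2]
  apply Complex.ext <;> simp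

/-- Integration by parts against a smooth real weight. -/
theorem integral_weight_mul {f f' : ℝ → ℂ} {u u' : ℝ → ℝ} {a b : ℝ} (hab : a ≤ b)
    (hf : AbsolutelyContinuousOnInterval f a b)
    (h : ∀ᵐ x, x ∈ Icc a b → HasDerivAt f (f' x) x)
    (hu : ∀ x, HasDerivAt u (u' x) x) (hu' : Continuous u') :
    ∫ x in a..b, (u x : ℂ) * f' x =
      (u b : ℂ) * f b - (u a : ℂ) * f a - ∫ x in a..b, (u' x : ℂ) * f x := by
  have hud : deriv u = u' := funext fun x => (hu x).deriv
  have huc : ContDiff ℝ 1 u := contDiff_one_iff_deriv.2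
    ⟨fun x => (hu x).differentiableAt, by rwa [hud]⟩
  have hacu : AbsolutelyContinuousOnInterval (fun x => (u x : ℂ)) a b :=
    absolutelyContinuous_ofReal huc.contDiffOn.absolutelyContinuousOnInterval
  have hprod : AbsolutelyContinuousOnInterval (fun x => (u x : ℂ) * f x) a b := hacu.smul hf
  have hfi := (integral_of_ae_hasDerivAt hab hf h).1
  have hfc : ContinuousOn f (uIcc a b) := hf.continuousOn
  have e := (integral_of_ae_hasDerivAt (f' := fun x => (u' x : ℂ) * f x + (u x : ℂ) * f' x) hab
    hprod (h.mono fun x hx hm => (hu x).ofReal_comp.mul (hx hm))).2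
  have i1 : IntervalIntegrable (fun x => (u' x : ℂ) * f x) volume a b :=
    ((Complex.continuous_ofReal.comp hu').continuousOn.mul hfc).intervalIntegrable
  have i2 : IntervalIntegrable (fun x => (u x : ℂ) * f' x) volume a b :=
    hfi.continuousOn_mul (Complex.continuous_ofReal.comp huc.continuous).continuousOn
  rw [intervalIntegral.integral_add i1 i2] at e
  rw [← e]; ring

/-! ### Chains of derivatives -/

/-- The functions `g 0, …, g m` are the successive derivatives of an element of the Sobolev space
of order `m` on `[a,b]`, the last one almost everywhere. -/
structure SobolevChain (m : ℕ) (a b : ℝ) (g : ℕ → ℝ → ℂ) : Prop where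
  hasDeriv : ∀ i, i + 1 < m → ∀ x ∈ Icc a b, HasDerivWithinAt (g i) (g (i + 1) x) (Icc a b) x
  ac : AbsolutelyContinuousOnInterval (g (m - 1)) a b
  ae_hasDeriv : ∀ᵐ x, x ∈ Icc a b → HasDerivAt (g (m - 1)) (g m x) x
  memLp : MemLp (g m) 2 (volume.restrict (Icc a b))

theorem ae_mem_Ioo {a b : ℝ} {p : ℝ → Prop} (h : ∀ x ∈ Ioo a b, p x) :
    ∀ᵐ x, x ∈ Icc a b → p x := by
  have h₁ : ∀ᵐ x : ℝ, x ≠ a := by simp [ae_iff, measure_singleton]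
  have h₂ : ∀ᵐ x : ℝ, x ≠ b := by simp [ae_iff, measure_singleton]
  filter_upwards [h₁, h₂] with x h1 h2 hx
  exact h x ⟨lt_of_le_of_ne hx.1 h1.symm, lt_of_le_of_ne hx.2 h2⟩

theorem MemSobolev.chain {m : ℕ} (hm : 1 ≤ m) {a b : ℝ} (hab : a < b) {φ : ℝ → ℂ}
    (h : MemSobolev m a b φ) :
    SobolevChain m a b (fun i => iteratedDerivWithin i φ (Icc a b)) := by
  have hu : UniqueDiffOn ℝ (Icc a b) := uniqueDiffOn_Icc hab
  refine ⟨fun i hi x hx => ?_, h.absolutelyContinuous, ?_, h.memLp⟩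
  · have hd := h.contDiffOn.differentiableOn_iteratedDerivWithin (m := i)
      (by exact_mod_cast (by omega : i < m - 1)) hu
    have := (hd x hx).hasDerivWithinAt
    simpa only [iteratedDerivWithin_succ] using this
  -- An absolutely continuous function has bounded variation, hence is differentiable almost
  -- everywhere.
  · have h1 := h.absolutelyContinuous.boundedVariationOn.ae_differentiableAt_of_mem_uIcc
    have h2 : ∀ᵐ x, x ∈ Icc a b → x ∈ Ioo a b := ae_mem_Ioo fun x hx => hx
    filter_upwards [h1, h2] with x hx1 hx2 hx
    have hd := hx1 (by rwa [uIcc_of_le hab.le])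
    obtain ⟨n, rfl⟩ : ∃ n, m = n + 1 := ⟨m - 1, by omega⟩
    have := hd.hasDerivAt
    simp only [iteratedDerivWithin_succ, Nat.add_sub_cancel] at this ⊢
    rwa [derivWithin_of_mem_nhds (Icc_mem_nhds (hx2 hx).1 (hx2 hx).2)]

namespace SobolevChain

variable {m : ℕ} {a b : ℝ} {g : ℕ → ℝ → ℂ}

theorem eqOn_iteratedDerivWithin (hab : a < b) (h : SobolevChain m a b g) :
    ∀ i, i < m → EqOn (iteratedDerivWithin i (g 0) (Icc a b)) (g i) (Icc a b) := by
  have hu : UniqueDiffOn ℝ (Icc a b) := uniqueDiffOn_Icc hab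
  intro i
  induction i with
  | zero => intro _ x _; simp
  | succ i ih =>
    intro hi x hx
    rw [iteratedDerivWithin_succ, derivWithin_congr (ih (by omega)) (ih (by omega) hx)]
    exact (h.hasDeriv i hi x hx).derivWithin (hu x hx)

theorem ae_eq_iteratedDerivWithin (hm : 1 ≤ m) (hab : a < b) (h : SobolevChain m a b g) :
    iteratedDerivWithin m (g 0) (Icc a b) =ᵐ[volume.restrict (Icc a b)] g m := by
  refine (ae_restrict_iff' measurableSet_Icc).2 ?_
  filter_upwards [h.ae_hasDeriv] with x hx hxm
  obtain ⟨n, rfl⟩ : ∃ n, m = n + 1 := ⟨m - 1, by omega⟩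
  have e := h.eqOn_iteratedDerivWithin hab n (by omega)
  rw [iteratedDerivWithin_succ, derivWithin_congr e (e hxm)]
  exact (hx hxm).hasDerivWithinAt.derivWithin (uniqueDiffOn_Icc hab x hxm)

theorem memSobolev (hm : 1 ≤ m) (hab : a < b) (h : SobolevChain m a b g) :
    MemSobolev m a b (g 0) := by
  have e := h.eqOn_iteratedDerivWithin hab
  refine ⟨?_, ?_, ?_⟩
  · have : ContDiffOn ℝ (((m - 1 : ℕ) : ℕ∞) : WithTop ℕ∞) (g 0) (Icc a b) := by
      apply contDiffOn_of_continuousOn_differentiableOn_deriv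
      · intro i hi
        have hi' : i ≤ m - 1 := by exact_mod_cast hi
        refine ContinuousOn.congr ?_ (e i (by omega))
        rcases hi'.lt_or_eq with h1 | rfl
        · exact fun x hx => (h.hasDeriv i (by omega) x hx).continuousWithinAt
        · simpa [uIcc_of_le hab.le] using h.ac.continuousOn
      · intro i hi
        have hi' : i < m - 1 := by exact_mod_cast hi
        exact DifferentiableOn.congr
          (fun x hx => (h.hasDeriv i (by omega) x hx).differentiableWithinAt) (e i (by omega))
    exact_mod_cast this
  · have e' := e (m - 1) (by omega)
    have := h.ac
    rw [absolutelyContinuousOnInterval_iff] at this ⊢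
    intro ε hε
    obtain ⟨δ, hδ, H⟩ := this ε hε
    refine ⟨δ, hδ, fun E hE hs => lt_of_eq_of_lt (Finset.sum_congr rfl fun i hi => ?_) (H E hE hs)⟩
    have := hE.1 i hi
    rw [uIcc_of_le hab.le] at this
    rw [e' this.1, e' this.2]
  · exact (memLp_congr_ae (h.ae_eq_iteratedDerivWithin hm hab)).2 h.memLp

theorem sobolevNorm_eq (hm : 1 ≤ m) (hab : a < b) (h : SobolevChain m a b g) :
    sobolevNorm m a b (g 0) = Real.sqrt (∫ x in a..b, ‖g m x‖ ^ 2) := by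
  rw [sobolevNorm]
  congr 1
  rw [intervalIntegral.integral_of_le hab.le, intervalIntegral.integral_of_le hab.le,
    ← integral_Icc_eq_integral_Ioc, ← integral_Icc_eq_integral_Ioc]
  exact integral_congr_ae ((h.ae_eq_iteratedDerivWithin hm hab).mono fun x hx => by simp [hx])

theorem add {g' : ℕ → ℝ → ℂ} (h : SobolevChain m a b g) (h' : SobolevChain m a b g') :
    SobolevChain m a b (fun i x => g i x + g' i x) where
  hasDeriv i hi x hx := (h.hasDeriv i hi x hx).add (h'.hasDeriv i hi x hx)
  ac := h.ac.add h'.ac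
  ae_hasDeriv := by
    filter_upwards [h.ae_hasDeriv, h'.ae_hasDeriv] with x h1 h2 hx using (h1 hx).add (h2 hx)
  memLp := h.memLp.add h'.memLp

theorem const_mul (c : ℂ) (h : SobolevChain m a b g) :
    SobolevChain m a b (fun i x => c * g i x) where
  hasDeriv i hi x hx := (h.hasDeriv i hi x hx).const_mul c
  ac := h.ac.const_smul c
  ae_hasDeriv := by
    filter_upwards [h.ae_hasDeriv] with x h1 hx using (h1 hx).const_mul c
  memLp := h.memLp.const_mul c

theorem continuousOn (hab : a < b) (h : SobolevChain m a b g) {i : ℕ} (hi : i < m) :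
    ContinuousOn (g i) (Icc a b) := by
  rcases (by omega : i + 1 < m ∨ i = m - 1) with h1 | rfl
  · exact fun x hx => (h.hasDeriv i h1 x hx).continuousWithinAt
  · simpa [uIcc_of_le hab.le] using h.ac.continuousOn

/-- Below the top order the next derivative is continuous, hence bounded on the compact interval, so
the function is Lipschitz. This lets integration by parts treat all orders alike. -/
theorem ac_of_lt (hab : a < b) (h : SobolevChain m a b g) {i : ℕ} (hi : i < m) :
    AbsolutelyContinuousOnInterval (g i) a b ∧
      ∀ᵐ x, x ∈ Icc a b → HasDerivAt (g i) (g (i + 1) x) x := by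
  rcases (by omega : i + 1 < m ∨ m = i + 1) with h1 | rfl
  · obtain ⟨B, hB⟩ := isCompact_Icc.exists_bound_of_continuousOn (h.continuousOn hab h1)
    have hl : LipschitzOnWith B.toNNReal (g i) (Icc a b) :=
      (convex_Icc a b).lipschitzOnWith_of_nnnorm_hasDerivWithin_le (h.hasDeriv i h1)
        (fun x hx => by
          rw [← NNReal.coe_le_coe, coe_nnnorm]
          exact (hB x hx).trans (Real.le_coe_toNNReal B))
    refine ⟨LipschitzOnWith.absolutelyContinuousOnInterval (K := B.toNNReal)
      (by rwa [uIcc_of_le hab.le]), ?_⟩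
    exact ae_mem_Ioo fun x hx =>
      (h.hasDeriv i h1 x (Ioo_subset_Icc_self hx)).hasDerivAt (Icc_mem_nhds hx.1 hx.2)
  · exact ⟨h.ac, h.ae_hasDeriv⟩

theorem ac_of_lt_right (hab : a < b) (h : SobolevChain m a b g) {i : ℕ} (hi : i < m) {c : ℝ}
    (hc : c ∈ Icc a b) :
    AbsolutelyContinuousOnInterval (g i) c b ∧
      ∀ᵐ x, x ∈ Icc c b → HasDerivAt (g i) (g (i + 1) x) x := by
  obtain ⟨h1, h2⟩ := h.ac_of_lt hab hi
  refine ⟨h1.mono ?_, h2.mono fun x hx hm => hx ⟨hc.1.trans hm.1, hm.2⟩⟩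
  rw [uIcc_of_le hab.le, uIcc_of_le hc.2]
  exact Icc_subset_Icc_left hc.1

theorem hasDerivAt_pow_div_factorial (c : ℝ) (s : ℕ) (x : ℝ) :
    HasDerivAt (fun x : ℝ => (x - c) ^ (s + 1) / (s + 1).factorial)
      ((x - c) ^ s / s.factorial) x := by
  have := (((hasDerivAt_id x).sub_const c).pow (s + 1)).div_const ((s + 1).factorial : ℝ)
  refine this.congr_deriv ?_
  have : (s.factorial : ℝ) ≠ 0 := by positivity
  rw [Nat.factorial_succ]
  push_cast
  simp only [id]
  field_simp

theorem integral_pow_succ_mul (hab : a < b) (h : SobolevChain m a b g) {i : ℕ} (hi : i < m) {c : ℝ}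
    (hc : c ∈ Icc a b) (s : ℕ) :
    ∫ x in c..b, (((x - c) ^ (s + 1) / (s + 1).factorial : ℝ) : ℂ) * g (i + 1) x =
      (((b - c) ^ (s + 1) / (s + 1).factorial : ℝ) : ℂ) * g i b
        - ∫ x in c..b, (((x - c) ^ s / s.factorial : ℝ) : ℂ) * g i x := by
  obtain ⟨h1, h2⟩ := h.ac_of_lt_right hab hi hc
  rw [integral_weight_mul hc.2 h1 h2 (hasDerivAt_pow_div_factorial c s) (by fun_prop)]
  simp

/-- Repeated integration by parts: the factor `x - c` kills every boundary term at `c`, so only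
those at `b` accumulate. -/
theorem integral_pow_mul_self (hab : a < b) (h : SobolevChain m a b g) {c : ℝ}
    (hc : c ∈ Icc a b) {i : ℕ} (hi : i ≤ m) :
    ∫ x in c..b, (((x - c) ^ i / i.factorial : ℝ) : ℂ) * g i x =
      (-1) ^ i * ((∫ x in c..b, g 0 x) - ∑ j ∈ Finset.range i,
        (-1) ^ j * (((b - c) ^ (j + 1) / (j + 1).factorial : ℝ) : ℂ) * g j b) := by
  induction i with
  | zero => simp
  | succ i ih =>
    rw [h.integral_pow_succ_mul hab (by omega) hc, ih (by omega), Finset.sum_range_succ]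
    have : ((-1 : ℂ) ^ i) * (-1) ^ i = 1 := by rw [← mul_pow]; simp
    rw [pow_succ (-1 : ℂ)]
    linear_combination (-(((b - c) ^ (i + 1) / (i + 1).factorial : ℝ) : ℂ) * g i b) * this

/-- Taylor's formula at `b` with integral remainder. It expresses the point value at `c` through the
highest derivative. -/
theorem integral_pow_mul_succ (hab : a < b) (h : SobolevChain m a b g) {c : ℝ}
    (hc : c ∈ Icc a b) {i : ℕ} (hi : i < m) :
    ∫ x in c..b, (((x - c) ^ i / i.factorial : ℝ) : ℂ) * g (i + 1) x =
      (-1) ^ (i + 1) * (g 0 c - ∑ j ∈ Finset.range (i + 1),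
        (-1) ^ j * (((b - c) ^ j / j.factorial : ℝ) : ℂ) * g j b) := by
  induction i with
  | zero =>
    obtain ⟨h1, h2⟩ := h.ac_of_lt_right hab hi hc
    simpa using (integral_of_ae_hasDerivAt hc.2 h1 h2).2
  | succ i ih =>
    rw [h.integral_pow_succ_mul hab (by omega) hc, ih (by omega), Finset.sum_range_succ _ (i + 1)]
    have : ((-1 : ℂ) ^ (i + 1)) * (-1) ^ (i + 1) = 1 := by rw [← mul_pow]; simp
    rw [pow_succ (-1 : ℂ) (i + 1)]
    linear_combination (-(((b - c) ^ (i + 1) / (i + 1).factorial : ℝ) : ℂ) * g (i + 1) b) * this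

theorem intervalIntegrable_last (hm : 1 ≤ m) (hab : a < b) (h : SobolevChain m a b g) :
    IntervalIntegrable (g m) volume a b := by
  have := h.ac_of_lt hab (i := m - 1) (by omega)
  rw [Nat.sub_add_cancel hm] at this
  exact (integral_of_ae_hasDerivAt hab.le this.1 this.2).1

end SobolevChain

/-! ### Splines -/

/-- The truncated power `(t - c)_+^i / i!`. -/
noncomputable def truncPow (i : ℕ) (c t : ℝ) : ℝ := if c ≤ t then (t - c) ^ i / i.factorial else 0

/-- At the knot both one-sided derivatives are zero when `i ≥ 1`; for `i = 0` the derivative jumps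
there, which the hypothesis excludes. -/
theorem hasDerivAt_truncPow (i : ℕ) (c t : ℝ) (h : 1 ≤ i ∨ t ≠ c) :
    HasDerivAt (truncPow (i + 1) c) (truncPow i c t) t := by
  rcases lt_trichotomy t c with h1 | rfl | h1
  · rw [truncPow, if_neg (not_le.2 h1)]
    refine (hasDerivAt_const t (0 : ℝ)).congr_of_eventuallyEq ?_
    filter_upwards [Iio_mem_nhds h1] with s hs
    rw [truncPow, if_neg (not_le.2 hs)]
  · have hi : i ≠ 0 := by rcases h with h | h; · omega
                          · exact absurd rfl h
    have e : truncPow i t t = 0 := by simp [truncPow, hi]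
    rw [e, ← hasDerivWithinAt_univ, ← Iic_union_Ici (a := t)]
    apply HasDerivWithinAt.union
    · refine (hasDerivWithinAt_const t _ (0 : ℝ)).congr (fun s hs => ?_) (by simp [truncPow])
      rcases (mem_Iic.1 hs).lt_or_eq with h2 | rfl
      · simp [truncPow, not_le.2 h2]
      · simp [truncPow]
    · have := (SobolevChain.hasDerivAt_pow_div_factorial t i t).hasDerivWithinAt (s := Ici t)
      simp only [sub_self, zero_pow hi, zero_div] at this
      refine this.congr (fun s hs => ?_) (by simp [truncPow])
      simp [truncPow, mem_Ici.1 hs]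
  · rw [truncPow, if_pos h1.le]
    refine (SobolevChain.hasDerivAt_pow_div_factorial c i t).congr_of_eventuallyEq ?_
    filter_upwards [Ioi_mem_nhds h1] with s hs
    rw [truncPow, if_pos (le_of_lt hs)]

theorem absolutelyContinuous_truncPow (i : ℕ) (c a b : ℝ) :
    AbsolutelyContinuousOnInterval (truncPow (i + 1) c) a b := by
  have h1 : AbsolutelyContinuousOnInterval (fun t => max (t - c) 0) a b := by
    have : LipschitzWith 1 (fun t : ℝ => max (t - c) 0) := by
      have h0 : LipschitzWith 1 (fun t : ℝ => t - c) :=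
        LipschitzWith.of_dist_le_mul fun x y => by simp
      exact h0.max_const 0
    exact this.lipschitzOnWith.absolutelyContinuousOnInterval
  have h2 : ∀ n : ℕ, AbsolutelyContinuousOnInterval (fun t => max (t - c) 0 ^ n) a b := by
    intro n
    induction n with
    | zero =>
      simp only [pow_zero]
      exact (contDiff_const (c := (1 : ℝ))).contDiffOn.absolutelyContinuousOnInterval
    | succ n ih => simpa only [pow_succ] using! ih.mul h1
  have e : truncPow (i + 1) c =
      fun t => ((i + 1).factorial : ℝ)⁻¹ * max (t - c) 0 ^ (i + 1) := by
    funext t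
    by_cases h : c ≤ t
    · rw [truncPow, if_pos h, max_eq_left (sub_nonneg.2 h)]; ring
    · rw [truncPow, if_neg h, max_eq_right (by linarith)]; simp
  rw [e]
  exact (h2 (i + 1)).const_mul _

theorem memLp_of_continuous {f : ℝ → ℝ} (hf : Continuous f) (a b : ℝ) :
    MemLp f 2 (volume.restrict (Icc a b)) := by
  obtain ⟨B, hB⟩ := isCompact_Icc.exists_bound_of_continuousOn (hf.continuousOn (s := Icc a b))
  exact MemLp.of_bound hf.aestronglyMeasurable B
    ((ae_restrict_iff' measurableSet_Icc).2 (Filter.Eventually.of_forall hB))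

theorem memLp_truncPow (i : ℕ) (c a b : ℝ) :
    MemLp (truncPow i c) 2 (volume.restrict (Icc a b)) := by
  have e : truncPow i c = (Ici c).indicator (fun t => (t - c) ^ i / i.factorial) := by
    funext t; simp [truncPow, indicator]
  rw [e]
  refine MemLp.indicator measurableSet_Ici ?_
  exact memLp_of_continuous (by fun_prop) a b

/-- The `i`-th derivative of the spline
`κ (t - a)^{2m} / (2m)! + p(t) - ∑_β C_β (t - x_β)_+^{2m-1} / (2m-1)!`. -/
noncomputable def spline {ι : Type*} [Fintype ι] (m : ℕ) (a κ : ℝ) (p : Polynomial ℝ)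
    (x C : ι → ℝ) (i : ℕ) (t : ℝ) : ℝ :=
  κ * ((t - a) ^ (2 * m - i) / (2 * m - i).factorial) + (Polynomial.derivative^[i] p).eval t
    - ∑ β, C β * truncPow (2 * m - 1 - i) (x β) t

section Spline

variable {ι : Type*} [Fintype ι] {m : ℕ} {a b κ : ℝ} {p : Polynomial ℝ} {x C : ι → ℝ}

theorem hasDerivAt_spline {i : ℕ} (hi : i < m) (t : ℝ) (h : i + 1 < m ∨ ∀ β, t ≠ x β) :
    HasDerivAt (spline m a κ p x C i) (spline m a κ p x C (i + 1) t) t := by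
  have e1 : 2 * m - i = 2 * m - (i + 1) + 1 := by omega
  have e2 : 2 * m - 1 - i = 2 * m - 1 - (i + 1) + 1 := by omega
  unfold spline
  rw [e1, e2, Function.iterate_succ_apply']
  refine (((SobolevChain.hasDerivAt_pow_div_factorial a _ t).const_mul κ).add
    ((Polynomial.derivative^[i] p).hasDerivAt t)).sub ?_
  refine HasDerivAt.fun_sum fun β _ => (hasDerivAt_truncPow _ _ _ ?_).const_mul (C β)
  -- The remaining exponent `2m - 2 - i` is at least `m - 1`; it can be zero only for `m = 1`, where
  -- the knots have to be avoided.
  rcases h with h | h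
  · left; omega
  · exact Or.inr (h β)

theorem absolutelyContinuous_finset_sum {ι : Type*} (s : Finset ι) {f : ι → ℝ → ℝ} {a b : ℝ}
    (h : ∀ i ∈ s, AbsolutelyContinuousOnInterval (f i) a b) :
    AbsolutelyContinuousOnInterval (fun t => ∑ i ∈ s, f i t) a b := by
  classical
  induction s using Finset.induction_on with
  | empty =>
    simp only [Finset.sum_empty]
    exact (contDiff_const (c := (0 : ℝ))).contDiffOn.absolutelyContinuousOnInterval
  | insert i s hi ih =>
    simp only [Finset.sum_insert hi]
    exact (h i (by simp)).add (ih fun j hj => h j (by simp [hj]))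

theorem memLp_spline (i : ℕ) :
    MemLp (spline m a κ p x C i) 2 (volume.restrict (Icc a b)) := by
  refine MemLp.sub (f := fun t => κ * ((t - a) ^ (2 * m - i) / (2 * m - i).factorial)
    + (Polynomial.derivative^[i] p).eval t)
    (memLp_of_continuous ?_ a b) ?_
  · have := (Polynomial.derivative^[i] p).continuous
    fun_prop
  · exact memLp_finsetSum _ fun β _ => (memLp_truncPow _ _ _ _).const_mul (C β)

theorem spline_chain (hm : 1 ≤ m) (p : Polynomial ℝ) (x C : ι → ℝ) :
    SobolevChain m a b (fun i t => (spline m a κ p x C i t : ℂ)) where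
  hasDeriv i hi t _ :=
    (hasDerivAt_spline (by omega) t (Or.inl hi)).ofReal_comp.hasDerivWithinAt
  ac := by
    refine absolutelyContinuous_ofReal ?_
    refine AbsolutelyContinuousOnInterval.sub (f := fun t => κ * ((t - a) ^ (2 * m - (m - 1)) /
      (2 * m - (m - 1)).factorial) + (Polynomial.derivative^[m - 1] p).eval t)
      (ContDiffOn.absolutelyContinuousOnInterval (ContDiff.contDiffOn ?_)) ?_
    · have : ContDiff ℝ 1 (fun t => (Polynomial.derivative^[m - 1] p).eval t) :=
        by
        simpa using! (Polynomial.derivative^[m - 1] p).contDiff_aeval (𝕜 := ℝ) 1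
      fun_prop
    · refine absolutelyContinuous_finset_sum _ fun β _ => ?_
      rw [show 2 * m - 1 - (m - 1) = m - 1 + 1 by omega]
      exact (absolutelyContinuous_truncPow _ _ _ _).const_mul (C β)
  ae_hasDeriv := by
    have : ∀ᵐ t : ℝ, ∀ β, t ≠ x β := by
      rw [ae_all_iff]; intro β; simp [ae_iff, measure_singleton]
    filter_upwards [this] with t ht _
    have := (hasDerivAt_spline (a := a) (κ := κ) (p := p) (C := C) (i := m - 1)
      (by omega : m - 1 < m) t (Or.inr ht)).ofReal_comp
    rwa [Nat.sub_add_cancel hm] at this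
  memLp := (memLp_spline m).ofReal

theorem integral_truncPow_mul {f : ℝ → ℂ} {c : ℝ} (hc : c ∈ Icc a b) (i : ℕ)
    (hf : IntervalIntegrable f volume a b) :
    IntervalIntegrable (fun t => (truncPow i c t : ℂ) * f t) volume a b ∧
    ∫ t in a..b, (truncPow i c t : ℂ) * f t =
      ∫ t in c..b, (((t - c) ^ i / i.factorial : ℝ) : ℂ) * f t := by
  have e1 : ∀ᵐ t : ℝ, t ∈ uIoc a c → (0 : ℂ) = (truncPow i c t : ℂ) * f t := by
    have : ∀ᵐ t : ℝ, t ≠ c := by simp [ae_iff, measure_singleton]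
    filter_upwards [this] with t ht h
    rw [uIoc_of_le hc.1] at h
    rw [truncPow, if_neg (not_le.2 (lt_of_le_of_ne h.2 ht))]; simp
  have e2 : ∀ᵐ t : ℝ, t ∈ uIoc c b →
      (((t - c) ^ i / i.factorial : ℝ) : ℂ) * f t = (truncPow i c t : ℂ) * f t :=
    Filter.Eventually.of_forall fun t h => by
      rw [uIoc_of_le hc.2] at h
      rw [truncPow, if_pos h.1.le]
  have i1 : IntervalIntegrable (fun t => (truncPow i c t : ℂ) * f t) volume a c :=
    (IntervalIntegrable.zero (E := ℂ)).congr_ae ((ae_restrict_iff' measurableSet_uIoc).2 e1)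
  have i2 : IntervalIntegrable (fun t => (truncPow i c t : ℂ) * f t) volume c b := by
    refine IntervalIntegrable.congr_ae (f := fun t => (((t - c) ^ i / i.factorial : ℝ) : ℂ) * f t)
      ?_ ((ae_restrict_iff' measurableSet_uIoc).2 e2)
    refine IntervalIntegrable.continuousOn_mul (hf.mono_set ?_) (Continuous.continuousOn ?_)
    · rw [uIcc_of_le hc.2, uIcc_of_le (hc.1.trans hc.2)]
      exact Icc_subset_Icc_left hc.1
    · exact Complex.continuous_ofReal.comp (by fun_prop)
  refine ⟨i1.trans i2, ?_⟩
  rw [← intervalIntegral.integral_add_adjacent_intervals i1 i2,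
    ← intervalIntegral.integral_congr_ae e1, ← intervalIntegral.integral_congr_ae e2]
  simp

/-- A functional that vanishes on the polynomials of degree less than `m` is represented by the
`m`-th derivative of the spline with the same coefficients. -/
theorem functional_eq_integral (hm : 1 ≤ m) (hab : a < b) (hp : Polynomial.derivative^[m] p = 0)
    (hx : ∀ β, x β ∈ Icc a b)
    (hmom : ∀ j < m, κ * ((b - a) ^ (j + 1) / (j + 1).factorial)
      = ∑ β, C β * ((b - x β) ^ j / j.factorial))
    {g : ℕ → ℝ → ℂ} (h : SobolevChain m a b g) :
    (κ : ℂ) * (∫ t in a..b, g 0 t) - ∑ β, (C β : ℂ) * g 0 (x β)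
      = (-1) ^ m * ∫ t in a..b, (spline m a κ p x C m t : ℂ) * g m t := by
  have hI := h.intervalIntegrable_last hm hab
  have hmm : 2 * m - m = m := by omega
  have hm1 : 2 * m - 1 - m = m - 1 := by omega
  have e : ∀ t, (spline m a κ p x C m t : ℂ) * g m t =
      (κ : ℂ) * ((((t - a) ^ m / m.factorial : ℝ) : ℂ) * g m t)
        - ∑ β, (C β : ℂ) * ((truncPow (m - 1) (x β) t : ℂ) * g m t) := by
    intro t
    rw [spline, hp, hmm, hm1, Complex.ofReal_sub, sub_mul, Complex.ofReal_sum, Finset.sum_mul,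
      Polynomial.eval_zero, add_zero]
    congr 1
    · push_cast; ring
    · exact Finset.sum_congr rfl fun β _ => by push_cast; ring
  have i0 : IntervalIntegrable
      (fun t => (κ : ℂ) * ((((t - a) ^ m / m.factorial : ℝ) : ℂ) * g m t)) volume a b :=
    (hI.continuousOn_mul (Continuous.continuousOn
      (Complex.continuous_ofReal.comp (by fun_prop)))).const_mul _
  have i1 : ∀ β, IntervalIntegrable
      (fun t => (C β : ℂ) * ((truncPow (m - 1) (x β) t : ℂ) * g m t)) volume a b :=
    fun β => (integral_truncPow_mul (hx β) (m - 1) hI).1.const_mul _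
  have k1 : ∀ β, ∫ t in a..b, (C β : ℂ) * ((truncPow (m - 1) (x β) t : ℂ) * g m t) =
      (-1) ^ m * ((C β : ℂ) * g 0 (x β) - ∑ j ∈ Finset.range m,
        (-1) ^ j * g j b * ((C β * ((b - x β) ^ j / j.factorial) : ℝ) : ℂ)) := by
    intro β
    rw [intervalIntegral.integral_const_mul, (integral_truncPow_mul (hx β) (m - 1) hI).2]
    have := h.integral_pow_mul_succ hab (hx β) (i := m - 1) (by omega)
    rw [Nat.sub_add_cancel hm] at this
    rw [this, mul_left_comm, mul_sub, Finset.mul_sum]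
    congr 2
    refine Finset.sum_congr rfl fun j _ => ?_
    push_cast; ring
  have i2 : IntervalIntegrable
      (fun t => ∑ β, (C β : ℂ) * ((truncPow (m - 1) (x β) t : ℂ) * g m t)) volume a b := by
    convert! IntervalIntegrable.sum Finset.univ fun β _ => i1 β
    simp
  simp_rw [e]
  rw [intervalIntegral.integral_sub i0 i2,
    intervalIntegral.integral_finsetSum fun β _ => i1 β, intervalIntegral.integral_const_mul,
    h.integral_pow_mul_self hab (left_mem_Icc.2 hab.le) le_rfl]
  simp_rw [k1]
  rw [← Finset.mul_sum, Finset.sum_sub_distrib, Finset.sum_comm]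
  -- Exactness in degree less than `m` makes the boundary terms at `b` of the integral and of the
  -- point values cancel.
  have k2 : ∑ j ∈ Finset.range m, ∑ β,
      (-1) ^ j * g j b * ((C β * ((b - x β) ^ j / j.factorial) : ℝ) : ℂ)
      = (κ : ℂ) * ∑ j ∈ Finset.range m,
        (-1) ^ j * (((b - a) ^ (j + 1) / (j + 1).factorial : ℝ) : ℂ) * g j b := by
    rw [Finset.mul_sum]
    refine Finset.sum_congr rfl fun j hj => ?_
    rw [← Finset.mul_sum, ← Complex.ofReal_sum, ← hmom j (Finset.mem_range.1 hj)]
    push_cast; ring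
  rw [k2]
  have : ((-1 : ℂ) ^ m) * (-1) ^ m = 1 := by rw [← mul_pow]; simp
  linear_combination (-((κ : ℂ) * (∫ t in a..b, g 0 t) - ∑ β, (C β : ℂ) * g 0 (x β))) * this

theorem intervalIntegrable_mul_of_memLp {f g : ℝ → ℝ} (hab : a < b)
    (hf : MemLp f 2 (volume.restrict (Icc a b))) (hg : MemLp g 2 (volume.restrict (Icc a b))) :
    IntervalIntegrable (fun t => f t * g t) volume a b := by
  rw [intervalIntegrable_iff_integrableOn_Icc_of_le hab.le]
  exact hf.integrable_mul hg

/-- The polynomial with value one at the node `x γ` and zero at the other nodes. -/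
theorem exists_cardinal_polynomial [DecidableEq ι] (hx : Function.Injective x) (γ : ι) :
    ∃ p : Polynomial ℝ, ∀ β, p.eval (x β) = if β = γ then 1 else 0 := by
  refine ⟨Lagrange.basis Finset.univ x γ, fun β => ?_⟩
  split_ifs with h
  · subst h
    exact Lagrange.eval_basis_self hx.injOn (Finset.mem_univ _)
  · exact Lagrange.eval_basis_of_ne (Ne.symm h) (Finset.mem_univ _)

/-- A natural spline of order `m` without polynomial part of degree `2m` that vanishes at its
knots has no jumps. -/
theorem coeff_eq_zero_of_vanish (hm : 1 ≤ m) (hab : a < b)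
    (hp : Polynomial.derivative^[m] p = 0)
    (hx : ∀ β, x β ∈ Icc a b) (hinj : Function.Injective x)
    (hmom : ∀ j < m, ∑ β, C β * ((b - x β) ^ j / j.factorial) = 0)
    (hv : ∀ β, spline m a 0 p x C 0 (x β) = 0) (γ : ι) : C γ = 0 := by
  classical
  have hid := fun {g : ℕ → ℝ → ℂ} (h : SobolevChain m a b g) =>
    functional_eq_integral (κ := 0) hm hab hp hx (fun j hj => by rw [hmom j hj, zero_mul]) h
  -- Testing the identity with the spline itself makes the left side zero, so its `m`-th derivative
  -- vanishes almost everywhere.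
  have h0 := hid (spline_chain (κ := 0) hm p x C)
  simp only [hv, Complex.ofReal_zero, mul_zero, zero_mul, Finset.sum_const_zero, sub_zero] at h0
  have h1 : ∫ t in a..b, spline m a 0 p x C m t * spline m a 0 p x C m t = 0 := by
    have h2 := mul_eq_zero.1 h0.symm
    have h3 := h2.resolve_left (pow_ne_zero _ (by norm_num))
    simp_rw [← Complex.ofReal_mul] at h3
    rw [intervalIntegral.integral_ofReal] at h3
    exact_mod_cast h3
  have h2 : ∀ᵐ t : ℝ, t ∈ Ioc a b → spline m a 0 p x C m t = 0 := by
    rw [intervalIntegral.integral_eq_zero_iff_of_le_of_nonneg_ae hab.le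
      (Filter.Eventually.of_forall fun t => mul_self_nonneg _)
      (intervalIntegrable_mul_of_memLp hab (memLp_spline m) (memLp_spline m))] at h1
    have := (ae_restrict_iff' measurableSet_Ioc).1 h1
    filter_upwards [this] with t ht hm
    exact mul_self_eq_zero.1 (ht hm)
  obtain ⟨ψ, hψ⟩ := exists_cardinal_polynomial hinj γ
  -- Testing with the cardinal polynomial, viewed as a spline without jumps, isolates the
  -- coefficient `C γ`.
  have h3 := hid (spline_chain (a := a) (b := b) (κ := 0) hm ψ x (fun _ => 0))
  have h4 : ∫ t in a..b, (spline m a 0 p x C m t : ℂ) *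
      (spline m a 0 ψ x (fun _ => 0) m t : ℂ) = 0 := by
    rw [intervalIntegral.integral_congr_ae (g := fun _ => (0 : ℂ))]
    · simp
    · filter_upwards [h2] with t ht hmem
      rw [uIoc_of_le hab.le] at hmem
      simp [ht hmem]
  rw [h4] at h3
  simpa [spline, hψ, apply_ite] using h3

end Spline

/-! ### Bounds for the error functional -/

theorem quadratureError_const_mul {N : ℕ} (a b : ℝ) (C : Fin (N + 1) → ℂ) (c : ℂ) (φ : ℝ → ℂ) :
    quadratureError a b C (fun x => c * φ x) = c * quadratureError a b C φ := by
  simp only [quadratureError, intervalIntegral.integral_const_mul, mul_sub, Finset.mul_sum]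
  congr 1
  exact Finset.sum_congr rfl fun β _ => by ring

theorem quadratureError_add {N : ℕ} {a b : ℝ} (C : Fin (N + 1) → ℂ) {φ ψ : ℝ → ℂ}
    (hφ : IntervalIntegrable φ volume a b) (hψ : IntervalIntegrable ψ volume a b) :
    quadratureError a b C (fun x => φ x + ψ x)
      = quadratureError a b C φ + quadratureError a b C ψ := by
  simp only [quadratureError, intervalIntegral.integral_add hφ hψ, mul_add,
    Finset.sum_add_distrib]
  ring

theorem SobolevChain.intervalIntegrable_zero {m : ℕ} {a b : ℝ} {g : ℕ → ℝ → ℂ} (hm : 1 ≤ m)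
    (hab : a < b) (h : SobolevChain m a b g) : IntervalIntegrable (g 0) volume a b :=
  ContinuousOn.intervalIntegrable (by simpa [uIcc_of_le hab.le] using h.continuousOn hab hm)

theorem MemSobolev.const_mul {m : ℕ} (hm : 1 ≤ m) {a b : ℝ} (hab : a < b) {φ : ℝ → ℂ}
    (h : MemSobolev m a b φ) (c : ℂ) : MemSobolev m a b (fun x => c * φ x) ∧
      sobolevNorm m a b (fun x => c * φ x) = ‖c‖ * sobolevNorm m a b φ := by
  have h1 := (h.chain hm hab).const_mul c
  have e := h1.sobolevNorm_eq hm hab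
  have h2 := h1.memSobolev hm hab
  simp only [iteratedDerivWithin_zero] at e h2
  refine ⟨h2, e.trans ?_⟩
  simp only [norm_mul, mul_pow, intervalIntegral.integral_const_mul]
  rw [Real.sqrt_mul (by positivity), Real.sqrt_sq (norm_nonneg c), sobolevNorm]

theorem norm_quadratureError_le {m N : ℕ} (hm : 1 ≤ m) {a b : ℝ} (hab : a < b)
    {C : Fin (N + 1) → ℂ} {σ : ℝ} (hσ : 0 ≤ σ) (h : errorNorm m a b C ≤ ENNReal.ofReal σ)
    {φ : ℝ → ℂ} (hφ : MemSobolev m a b φ) :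
    ‖quadratureError a b C φ‖ ≤ σ * sobolevNorm m a b φ := by
  have hs : 0 ≤ sobolevNorm m a b φ := Real.sqrt_nonneg _
  -- The norm of `φ` may be zero, so `φ` is normalized by `sobolevNorm m a b φ + ε` instead.
  have key : ∀ ε : ℝ, 0 < ε → ‖quadratureError a b C φ‖ ≤ σ * (sobolevNorm m a b φ + ε) := by
    intro ε hε
    set s := sobolevNorm m a b φ
    have hsε : 0 < s + ε := by positivity
    obtain ⟨h1, h2⟩ := hφ.const_mul hm hab (((s + ε)⁻¹ : ℝ) : ℂ)
    have hn : ‖(((s + ε)⁻¹ : ℝ) : ℂ)‖ = (s + ε)⁻¹ := by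
      rw [Complex.norm_real, Real.norm_of_nonneg (by positivity)]
    have h3 : sobolevNorm m a b (fun x => (((s + ε)⁻¹ : ℝ) : ℂ) * φ x) ≤ 1 := by
      rw [h2, hn, inv_mul_le_one₀ hsε]; linarith
    have h4 : ‖quadratureError a b C (fun x => (((s + ε)⁻¹ : ℝ) : ℂ) * φ x)‖ₑ
        ≤ ENNReal.ofReal σ :=
      le_trans (le_iSup_of_le (f := fun φ : ℝ → ℂ => ⨆ (_ : MemSobolev m a b φ)
        (_ : sobolevNorm m a b φ ≤ 1), ‖quadratureError a b C φ‖ₑ) _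
        (le_iSup₂_of_le h1 h3 le_rfl)) h
    rw [← ofReal_norm, ENNReal.ofReal_le_ofReal_iff hσ, quadratureError_const_mul, norm_mul, hn,
      inv_mul_le_iff₀ hsε] at h4
    linarith
  by_contra! hlt
  have h5 := key ((‖quadratureError a b C φ‖ - σ * sobolevNorm m a b φ) / (σ + 1))
    (div_pos (by linarith) (by linarith))
  have h6 : σ * ((‖quadratureError a b C φ‖ - σ * sobolevNorm m a b φ) / (σ + 1))
      < ‖quadratureError a b C φ‖ - σ * sobolevNorm m a b φ := by
    rw [mul_div_assoc', div_lt_iff₀ (by linarith)]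
    nlinarith
  linarith

theorem errorNorm_le {m N : ℕ} {a b : ℝ} {C : Fin (N + 1) → ℂ} {σ : ℝ} (hσ : 0 ≤ σ)
    (h : ∀ φ, MemSobolev m a b φ → ‖quadratureError a b C φ‖ ≤ σ * sobolevNorm m a b φ) :
    errorNorm m a b C ≤ ENNReal.ofReal σ := by
  refine iSup_le fun φ => iSup_le fun h1 => iSup_le fun h2 => ?_
  rw [← ofReal_norm]
  exact ENNReal.ofReal_le_ofReal ((h φ h1).trans (by nlinarith))

theorem norm_integral_mul_le {f : ℝ → ℝ} {g : ℝ → ℂ} {a b : ℝ} (hab : a < b)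
    (hf : MemLp f 2 (volume.restrict (Icc a b))) (hg : MemLp g 2 (volume.restrict (Icc a b))) :
    ‖∫ t in a..b, (f t : ℂ) * g t‖ ≤
      Real.sqrt (∫ t in a..b, f t ^ 2) * Real.sqrt (∫ t in a..b, ‖g t‖ ^ 2) := by
  refine (intervalIntegral.norm_integral_le_integral_norm hab.le).trans ?_
  have h := integral_mul_norm_le_Lp_mul_Lq (μ := volume.restrict (Icc a b)) (p := 2) (q := 2)
    (f := fun t => (f t : ℂ)) (g := g) Real.HolderConjugate.two_two
    (by simpa using! hf.ofReal) (by simpa using hg)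
  simp only [intervalIntegral.integral_of_le hab.le, ← integral_Icc_eq_integral_Ioc, norm_mul]
  rw [Real.sqrt_eq_rpow, Real.sqrt_eq_rpow]
  simpa using h

/-- A functional of norm at most `σ` that takes its norm at `F` is determined by `F`. -/
theorem eq_zero_of_quadratic_bound {σ B E : ℝ} {D : ℂ} {s : ℝ} (hs : s ^ 2 = 1) (hE : 0 ≤ E)
    (hσ : 0 < σ)
    (h : ∀ t : ℂ, ‖(s : ℂ) * (σ : ℂ) ^ 2 + t * ((s : ℂ) * B + D)‖ ^ 2 ≤
      σ ^ 2 * (σ ^ 2 + 2 * t.re * B + ‖t‖ ^ 2 * E)) : D = 0 := by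
  set r : ℝ := (E + 1)⁻¹ with hr
  have hrpos : 0 < r := by positivity
  -- The phase of `conj D` turns the linear gain into the real number `r |D|²`; the choice of `r`
  -- gives `r E ≤ 1`, so the quadratic term `r² |D|² E` cannot compensate twice this gain.
  have h1 := h ((r * s : ℝ) * (starRingEnd ℂ) D)
  have hsa : |s| = 1 := by
    rw [← Real.sqrt_sq_eq_abs, hs, Real.sqrt_one]
  set δ := Complex.normSq D with hδ
  have e1 : (s : ℂ) * (σ : ℂ) ^ 2 + ((r * s : ℝ) * (starRingEnd ℂ) D) * ((s : ℂ) * B + D)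
      = (s : ℂ) * ((σ ^ 2 + r * δ : ℝ) + (r * s * B : ℝ) * (starRingEnd ℂ) D) := by
    have : (starRingEnd ℂ) D * D = δ := by rw [mul_comm, Complex.mul_conj]
    push_cast
    linear_combination (r * s : ℂ) * this
  have e2 : (σ ^ 2 + r * δ + r * s * B * D.re) ^ 2 ≤
      ‖(s : ℂ) * ((σ ^ 2 + r * δ : ℝ) + (r * s * B : ℝ) * (starRingEnd ℂ) D)‖ ^ 2 := by
    rw [norm_mul, Complex.norm_real, Real.norm_eq_abs, hsa, one_mul, ← Complex.normSq_eq_norm_sq,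
      Complex.normSq_apply]
    have : ((σ ^ 2 + r * δ : ℝ) + (r * s * B : ℝ) * (starRingEnd ℂ) D : ℂ).re
        = σ ^ 2 + r * δ + r * s * B * D.re := by
      rw [Complex.add_re, Complex.re_ofReal_mul, Complex.ofReal_re, Complex.conj_re]
    rw [this]
    nlinarith [mul_self_nonneg ((σ ^ 2 + r * δ : ℝ) + (r * s * B : ℝ) * (starRingEnd ℂ) D : ℂ).im]
  rw [e1] at h1
  have e3 : (((r * s : ℝ) : ℂ) * (starRingEnd ℂ) D).re = r * s * D.re := by
    rw [Complex.re_ofReal_mul, Complex.conj_re]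
  have e4 : ‖((r * s : ℝ) : ℂ) * (starRingEnd ℂ) D‖ ^ 2 = r ^ 2 * δ := by
    rw [norm_mul, Complex.norm_conj, mul_pow, ← Complex.normSq_eq_norm_sq D, Complex.norm_real,
      Real.norm_eq_abs, sq_abs, mul_pow, hs, mul_one]
  rw [e3, e4] at h1
  have h2 := e2.trans h1
  have hδ0 : 0 ≤ δ := Complex.normSq_nonneg D
  have h3 : 2 * r * (σ ^ 2 * δ) ≤ r * (r * E) * (σ ^ 2 * δ) := by
    nlinarith [sq_nonneg (r * δ + r * s * B * D.re)]
  have h4 : r * E ≤ 1 := by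
    rw [hr, inv_mul_le_iff₀ (by positivity)]; linarith
  have h5 : r * (σ ^ 2 * δ) ≤ 0 := by
    have : 0 ≤ r * (σ ^ 2 * δ) := by positivity
    nlinarith
  have h6 : δ = 0 := by
    by_contra hne
    have : 0 < δ := lt_of_le_of_ne hδ0 (Ne.symm hne)
    have : 0 < r * (σ ^ 2 * δ) := by positivity
    linarith
  exact Complex.normSq_eq_zero.1 h6

/-! ### Optimal coefficients -/

/-- Coefficients of a formula that is exact on polynomials of degree less than `m` and whose
associated spline vanishes at the nodes are the only optimal ones. -/
theorem isSardOptimal_iff {m N : ℕ} (hm : 1 ≤ m) (hN : 1 ≤ N) {a b : ℝ} (hab : a < b)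
    {C : Fin (N + 1) → ℝ} {p : Polynomial ℝ} (hp : Polynomial.derivative^[m] p = 0)
    {x : Fin (N + 1) → ℝ} (hx : ∀ β, x β = (b - a) / N * (β : ℝ) + a)
    (hmom : ∀ j < m, (b - a) ^ (j + 1) / (j + 1).factorial
      = ∑ β, C β * ((b - x β) ^ j / j.factorial))
    (hv : ∀ β, spline m a 1 p x C 0 (x β) = 0) (C' : Fin (N + 1) → ℂ) :
    IsSardOptimal m a b C' ↔ ∀ β, C' β = (C β : ℂ) := by
  have hN0 : (0 : ℝ) < N := by exact_mod_cast hN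
  have hinj : Function.Injective x := by
    intro β γ h
    have hpos : (b - a) / N ≠ 0 := (div_pos (sub_pos.2 hab) hN0).ne'
    rw [hx, hx] at h
    have : (β : ℝ) = γ := mul_left_cancel₀ hpos (by linarith)
    exact Fin.ext (by exact_mod_cast this)
  have hmem : ∀ β, x β ∈ Icc a b := by
    intro β
    have h1 : (0 : ℝ) ≤ (b - a) / N := (div_pos (sub_pos.2 hab) hN0).le
    have h2 : (β : ℝ) ≤ N := by exact_mod_cast Nat.lt_succ_iff.1 β.2
    have h3 : (b - a) / N * N = b - a := by field_simp
    rw [hx]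
    constructor
    · have : 0 ≤ (b - a) / N * (β : ℝ) := by positivity
      linarith
    · nlinarith [mul_le_mul_of_nonneg_left h2 h1]
  have hid : ∀ {g : ℕ → ℝ → ℂ}, SobolevChain m a b g →
      quadratureError a b (fun β => (C β : ℂ)) (g 0)
        = (-1) ^ m * ∫ t in a..b, (spline m a 1 p x C m t : ℂ) * g m t := by
    intro g h
    rw [← functional_eq_integral (κ := 1) hm hab hp hmem (by simpa using hmom) h]
    simp [quadratureError, hx]
  set F : ℕ → ℝ → ℂ := fun i t => (spline m a 1 p x C i t : ℂ) with hFdef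
  have hF : SobolevChain m a b F := spline_chain hm p x C
  set σ : ℝ := Real.sqrt (∫ t in a..b, spline m a 1 p x C m t ^ 2) with hσdef
  have hσ : 0 ≤ σ := Real.sqrt_nonneg _
  have hint0 : 0 ≤ ∫ t in a..b, spline m a 1 p x C m t ^ 2 :=
    intervalIntegral.integral_nonneg hab.le fun t _ => sq_nonneg _
  have hσ2 : ∫ t in a..b, spline m a 1 p x C m t ^ 2 = σ ^ 2 := (Real.sq_sqrt hint0).symm
  have hnormF : sobolevNorm m a b (F 0) = σ := by
    rw [hF.sobolevNorm_eq hm hab]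
    simp [hFdef, hσdef, Complex.norm_real]
  have hsob := hF.memSobolev hm hab
  have hle : errorNorm m a b (fun β => (C β : ℂ)) ≤ ENNReal.ofReal σ := by
    refine errorNorm_le hσ fun φ hφ => ?_
    have hc := hφ.chain hm hab
    have h1 := hid hc
    simp only [iteratedDerivWithin_zero] at h1
    rw [h1, norm_mul, norm_pow, norm_neg, norm_one, one_pow, one_mul, sobolevNorm]
    exact norm_integral_mul_le hab (memLp_spline m) hc.memLp
  have hCF : quadratureError a b (fun β => (C β : ℂ)) (F 0) = ((-1 : ℝ) ^ m : ℝ) * (σ : ℂ) ^ 2 := by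
    rw [hid hF]
    simp only [hFdef, ← pow_two, ← Complex.ofReal_pow]
    rw [intervalIntegral.integral_ofReal, hσ2]
    push_cast; ring
  -- Since the spline vanishes at the nodes, the coefficients do not enter: all formulas have the
  -- same error there.
  have hLF : ∀ C'' : Fin (N + 1) → ℂ,
      quadratureError a b C'' (F 0) = ((-1 : ℝ) ^ m : ℝ) * (σ : ℂ) ^ 2 := by
    intro C''
    rw [← hCF]
    simp only [quadratureError, ← hx]
    simp [hFdef, hv]
  have hlow : ∀ C'' : Fin (N + 1) → ℂ, ENNReal.ofReal σ ≤ errorNorm m a b C'' := by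
    intro C''
    by_cases htop : errorNorm m a b C'' = ∞
    · simp [htop]
    · have h1 := norm_quadratureError_le hm hab (σ := (errorNorm m a b C'').toReal)
        ENNReal.toReal_nonneg (ENNReal.ofReal_toReal htop).ge hsob
      rw [hLF, hnormF, norm_mul, norm_pow, Complex.norm_real, Complex.norm_real, norm_pow,
        norm_neg, norm_one, one_pow, one_mul, Real.norm_of_nonneg hσ] at h1
      rw [← ENNReal.ofReal_toReal htop]
      refine ENNReal.ofReal_le_ofReal ?_
      rcases hσ.eq_or_lt with h0 | h0
      · rw [← h0]; exact ENNReal.toReal_nonneg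
      · nlinarith
  have heq : errorNorm m a b (fun β => (C β : ℂ)) = ENNReal.ofReal σ := le_antisymm hle (hlow _)
  have hinf : ⨅ C'' : Fin (N + 1) → ℂ, errorNorm m a b C'' = ENNReal.ofReal σ :=
    le_antisymm (iInf_le_of_le _ hle) (le_iInf hlow)
  constructor
  · intro hopt γ
    have hC' : errorNorm m a b C' ≤ ENNReal.ofReal σ := (hopt.norm_eq_iInf.trans hinf).le
    obtain ⟨ψ, hψ⟩ := exists_cardinal_polynomial hinj γ
    set G : ℕ → ℝ → ℂ := fun i t => (spline m a 0 ψ x (fun _ => 0) i t : ℂ) with hGdef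
    have hG : SobolevChain m a b G := spline_chain hm ψ x _
    have hGx : ∀ β, G 0 (x β) = if β = γ then 1 else 0 := by
      intro β; simp [hGdef, spline, hψ, apply_ite]
    have hdiff : quadratureError a b C' (G 0) - quadratureError a b (fun β => (C β : ℂ)) (G 0)
        = (C γ : ℂ) - C' γ := by
      simp only [quadratureError, ← hx, hGx]
      simp
    suffices quadratureError a b C' (G 0) - quadratureError a b (fun β => (C β : ℂ)) (G 0) = 0 by
      rw [hdiff, sub_eq_zero] at this
      exact this.symm
    -- If `σ = 0`, both functionals vanish on the whole space. Otherwise perturb the extremal spline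
    -- by complex multiples of the cardinal polynomial.
    rcases hσ.eq_or_lt with h0 | h0
    · have h1 := norm_quadratureError_le hm hab hσ hC' (hG.memSobolev hm hab)
      have h2 := norm_quadratureError_le hm hab hσ heq.le (hG.memSobolev hm hab)
      rw [← h0, zero_mul] at h1 h2
      rw [norm_le_zero_iff.1 h1, norm_le_zero_iff.1 h2, sub_zero]
    · set B : ℝ := ∫ t in a..b, spline m a 1 p x C m t * spline m a 0 ψ x (fun _ => 0) m t with hB
      set E : ℝ := ∫ t in a..b, spline m a 0 ψ x (fun _ => 0) m t ^ 2 with hE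
      have hCG : quadratureError a b (fun β => (C β : ℂ)) (G 0) = ((-1 : ℝ) ^ m : ℝ) * (B : ℂ) := by
        rw [hid hG]
        simp only [hGdef, ← Complex.ofReal_mul]
        rw [intervalIntegral.integral_ofReal]
        push_cast; ring
      refine eq_zero_of_quadratic_bound (σ := σ) (B := B) (E := E) (s := (-1) ^ m)
        (by rw [← pow_mul, mul_comm, pow_mul]; simp)
        (intervalIntegral.integral_nonneg hab.le fun t _ => sq_nonneg _) h0 fun t => ?_
      have hch := hF.add (hG.const_mul t)
      have h1 := norm_quadratureError_le hm hab hσ hC' (hch.memSobolev hm hab)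
      rw [hch.sobolevNorm_eq hm hab, quadratureError_add C' (hF.intervalIntegrable_zero hm hab)
        ((hG.const_mul t).intervalIntegrable_zero hm hab), hLF, quadratureError_const_mul] at h1
      have h2 : ∫ y in a..b, ‖F m y + t * G m y‖ ^ 2 = σ ^ 2 + 2 * t.re * B + ‖t‖ ^ 2 * E := by
        have e : ∀ y, ‖F m y + t * G m y‖ ^ 2 = spline m a 1 p x C m y ^ 2
            + (2 * t.re * (spline m a 1 p x C m y * spline m a 0 ψ x (fun _ => 0) m y)
            + ‖t‖ ^ 2 * spline m a 0 ψ x (fun _ => 0) m y ^ 2) := by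
          intro y
          rw [← Complex.normSq_eq_norm_sq, ← Complex.normSq_eq_norm_sq, Complex.normSq_apply,
            Complex.normSq_apply]
          simp only [hFdef, hGdef, Complex.add_re, Complex.add_im, Complex.re_mul_ofReal,
            Complex.im_mul_ofReal, Complex.ofReal_re, Complex.ofReal_im]
          ring
        have m1 : MemLp (spline m a 1 p x C m) 2 (volume.restrict (Icc a b)) := memLp_spline m
        have m2 : MemLp (spline m a 0 ψ x (fun _ => 0) m) 2 (volume.restrict (Icc a b)) :=
          memLp_spline m
        have i1 := intervalIntegrable_mul_of_memLp hab m1 m1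
        have i2 := (intervalIntegrable_mul_of_memLp hab m1 m2).const_mul (2 * t.re)
        have i3 := (intervalIntegrable_mul_of_memLp hab m2 m2).const_mul (‖t‖ ^ 2)
        simp only [← pow_two] at i1 i3
        simp_rw [e]
        rw [intervalIntegral.integral_add i1 (i2.add i3), intervalIntegral.integral_add i2 i3,
          intervalIntegral.integral_const_mul, intervalIntegral.integral_const_mul, hσ2]
        ring
      have h3 : 0 ≤ σ ^ 2 + 2 * t.re * B + ‖t‖ ^ 2 * E := by
        rw [← h2]
        exact intervalIntegral.integral_nonneg hab.le fun t _ => sq_nonneg _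
      have h4 := pow_le_pow_left₀ (norm_nonneg _) h1 2
      rw [mul_pow, h2, Real.sq_sqrt h3] at h4
      rw [hCG]
      refine le_trans (le_of_eq ?_) h4
      congr 2
      ring
  · intro h
    have hC'' : C' = fun β => (C β : ℂ) := funext h
    subst hC''
    exact ⟨by rw [heq]; exact ENNReal.ofReal_ne_top, heq.trans hinf.symm⟩

/-! ### Generating polynomials of geometrically weighted power sums -/

open Polynomial in
/-- The polynomial `A_j` with `∑_l l^j q^l = A_j(1 / (1 - q))` for `|q| < 1`. -/
noncomputable def powerSeriesPoly : ℕ → ℝ[X]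
  | 0 => X
  | j + 1 => X * (X - 1) * derivative (powerSeriesPoly j)

section PowerSeriesPoly

open Polynomial

local notation "A" => powerSeriesPoly

/-- This is `∑ l^j λ^l = 0^j + λ ∑ (l + 1)^j λ^l`, multiplied by `u = 1/(1 - λ)` and written with `u
λ = u - 1`. The induction applies `X (X - 1) d/dX`, the form of `λ d/dλ` in the variable `u`. -/
theorem X_mul_powerSeriesPoly (j : ℕ) :
    X * A j = (if j = 0 then X else 0) +
      (X - 1) * ∑ i ∈ Finset.range (j + 1), (j.choose i : ℝ[X]) * A i := by
  induction j with
  | zero => simp [powerSeriesPoly]; ring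
  | succ j ih =>
    have hd := congrArg (fun p => X * (X - 1) * derivative p) ih
    have hif : derivative (if j = 0 then (X : ℝ[X]) else 0) = (if j = 0 then 1 else 0) := by
      split_ifs <;> simp
    simp only [derivative_mul, derivative_add, derivative_X, derivative_sub, derivative_one,
      derivative_sum, derivative_natCast, zero_mul, zero_add, hif] at hd
    have h1 : X * (X - 1) * ((1 - 0) * ∑ i ∈ Finset.range (j + 1), (j.choose i : ℝ[X]) * A i
        + (X - 1) * ∑ i ∈ Finset.range (j + 1), (j.choose i : ℝ[X]) * derivative (A i))
        = X * (X - 1) * ∑ i ∈ Finset.range (j + 1), (j.choose i : ℝ[X]) * A i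
        + (X - 1) * ∑ i ∈ Finset.range (j + 1), (j.choose i : ℝ[X]) * A (i + 1) := by
      simp only [powerSeriesPoly]
      rw [mul_add, sub_zero, one_mul, Finset.mul_sum (Finset.range (j + 1)) _ (X - 1),
        Finset.mul_sum (Finset.range (j + 1)) _ (X * (X - 1)),
        Finset.mul_sum (Finset.range (j + 1)) _ (X * (X - 1)),
        Finset.mul_sum (Finset.range (j + 1)) _ (X - 1)]
      congr 1
      exact Finset.sum_congr rfl fun i _ => by ring
    have h2 : ∑ i ∈ Finset.range (j + 2), ((j + 1).choose i : ℝ[X]) * A i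
        = ∑ i ∈ Finset.range (j + 1), (j.choose i : ℝ[X]) * A i
          + ∑ i ∈ Finset.range (j + 1), (j.choose i : ℝ[X]) * A (i + 1) := by
      rw [Finset.sum_range_succ', Finset.sum_range_succ' (fun i => (j.choose i : ℝ[X]) * A i),
        Finset.sum_range_succ _ j]
      simp only [Nat.choose_succ_succ, Nat.cast_add, add_mul, Finset.sum_add_distrib]
      rw [Finset.sum_range_succ (fun i => (j.choose i : ℝ[X]) * A (i + 1))]
      simp
      ring
    rw [h2, if_neg (Nat.succ_ne_zero j), zero_add]
    have h3 : X * (X - 1) * (1 * A j + X * derivative (A j)) =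
        X * (X - 1) * A j + X * A (j + 1) := by
      simp only [powerSeriesPoly]; ring
    rw [one_mul] at h3 hd
    rw [h3, mul_add, h1] at hd
    have h4 : (X - 1) * (if j = 0 then (X : ℝ[X]) else 0)
        = X * (X - 1) * (if j = 0 then 1 else 0) := by
      split_ifs <;> ring
    linear_combination hd - (X - 1) * ih - h4

/-- The reflection `u ↦ 1 - u` fixes `X (X - 1)` and reverses the sign of the derivative. In terms
of `λ` it is `λ ↦ 1/λ`. -/
theorem powerSeriesPoly_eval_one_sub (j : ℕ) (u : ℝ) :
    (A (j + 1)).eval (1 - u) = (-1) ^ j * (A (j + 1)).eval u := by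
  have key : (A (j + 1)).comp (1 - X) = (-1) ^ j * A (j + 1) := by
    induction j with
    | zero => simp [powerSeriesPoly]; ring
    | succ j ih =>
      have hd := congrArg derivative ih
      rw [derivative_comp] at hd
      have h1 : derivative ((-1 : ℝ[X]) ^ j * A (j + 1)) = (-1) ^ j * derivative (A (j + 1)) := by
        have : ((-1 : ℝ[X]) ^ j) = C ((-1) ^ j) := by simp
        rw [this, derivative_C_mul]
      rw [h1] at hd
      simp only [derivative_sub, derivative_one, derivative_X] at hd
      rw [powerSeriesPoly, mul_comp, mul_comp, sub_comp, X_comp, one_comp, pow_succ]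
      linear_combination (-(X * (X - 1))) * hd
  have := congrArg (eval u) key
  simpa [eval_comp] using this

theorem sum_Icc_one_eq_sum_range {M : Type*} [AddCommMonoid M] (f : ℕ → M) (n : ℕ) :
    ∑ l ∈ Finset.Icc 1 n, f l = ∑ k ∈ Finset.range n, f (k + 1) := by
  rw [← Finset.Ico_add_one_right_eq_Icc, Finset.sum_Ico_eq_sum_range]
  simp [add_comm]

/-- The recurrence of the numbers `i! S(j, i)` with Stirling numbers of the second kind, from
Pascal's rule and absorption of `l` into the binomial coefficient. -/
theorem diffZeroPow_succ (i j : ℕ) :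
    diffZeroPow (i + 1) (j + 1) = (i + 1) * (diffZeroPow (i + 1) j + diffZeroPow i j) := by
  unfold diffZeroPow
  have e : ∀ f : ℕ → ℝ, ∑ l ∈ Finset.Icc 1 (i + 1), f l = ∑ l ∈ Finset.Icc 1 i, f l + f (i + 1) :=
    fun f => Finset.sum_Icc_succ_top (by omega) f
  rw [e, e, mul_add, mul_add, add_right_comm, ← mul_add, ← Finset.sum_add_distrib, Finset.mul_sum]
  congr 1
  · refine Finset.sum_congr rfl fun l hl => ?_
    obtain ⟨hl1, hl2⟩ := Finset.mem_Icc.1 hl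
    obtain ⟨l, rfl⟩ : ∃ l', l = l' + 1 := ⟨l - 1, by omega⟩
    have h1 : ((i + 1).choose (l + 1) : ℝ) = i.choose l + i.choose (l + 1) := by
      rw [Nat.choose_succ_succ]; push_cast; ring
    have h2 : ((i : ℝ) + 1) * i.choose l = (i + 1).choose (l + 1) * (l + 1) := by
      exact_mod_cast Nat.add_one_mul_choose_eq i l
    have h3 : i + 1 - (l + 1) = i - (l + 1) + 1 := by omega
    rw [h3, pow_succ, pow_succ]
    push_cast
    linear_combination ((-1) ^ (i - (l + 1)) * ((l : ℝ) + 1) ^ j) * (h2 + ((i : ℝ) + 1) * h1)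
  · simp [pow_succ]; ring

theorem diffZeroPow_zero_right (i : ℕ) : diffZeroPow (i + 1) 0 = (-1) ^ i := by
  -- The defining sum starts at `l = 1`; without its `l = 0` term the alternating binomial sum is
  -- not zero.
  have h := add_pow (1 : ℝ) (-1) (i + 1)
  rw [Finset.sum_range_succ'] at h
  have h2 : diffZeroPow (i + 1) 0 = ∑ k ∈ Finset.range (i + 1),
      (1 : ℝ) ^ (k + 1) * (-1) ^ (i + 1 - (k + 1)) * ((i + 1).choose (k + 1)) := by
    rw [diffZeroPow, sum_Icc_one_eq_sum_range]
    refine Finset.sum_congr rfl fun l _ => by simp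
  rw [h2]
  simp [pow_succ] at h ⊢
  linarith

theorem diffZeroPow_eq_zero (j i : ℕ) (h : j < i) : diffZeroPow (i + 1) (j + 1) = 0 := by
  induction j generalizing i with
  | zero =>
    obtain ⟨i, rfl⟩ : ∃ i', i = i' + 1 := ⟨i - 1, by omega⟩
    rw [diffZeroPow_succ, diffZeroPow_zero_right, diffZeroPow_zero_right]
    ring
  | succ j ih =>
    obtain ⟨i, rfl⟩ : ∃ i', i = i' + 1 := ⟨i - 1, by omega⟩
    rw [diffZeroPow_succ, ih (i + 1) (by omega), ih i (by omega)]
    ring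

/-- The operator `X (X - 1) d/dX` sends `X (X - 1)^(i+1)` to `(i + 2) X (X - 1)^(i+2) + (i + 1) X (X
- 1)^(i+1)`, which reproduces the recurrence `diffZeroPow_succ` for the coefficients. -/
theorem powerSeriesPoly_eq_sum (j : ℕ) :
    A (j + 1) = ∑ i ∈ Finset.range (j + 1),
      C (diffZeroPow (i + 1) (j + 1)) * (X * (X - 1) ^ (i + 1)) := by
  induction j with
  | zero => simp [powerSeriesPoly, diffZeroPow]
  | succ j ih =>
    have hθ : ∀ i : ℕ, X * (X - 1) * derivative (X * (X - 1 : ℝ[X]) ^ (i + 1))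
        = C ((i : ℝ) + 2) * (X * (X - 1) ^ (i + 2)) + C ((i : ℝ) + 1) * (X * (X - 1) ^ (i + 1)) := by
      intro i
      simp only [derivative_mul, derivative_X, derivative_pow, derivative_sub, derivative_one,
        Nat.add_sub_cancel, Nat.cast_add, Nat.cast_one, map_add, map_one, map_natCast, map_ofNat]
      ring
    rw [powerSeriesPoly, ih, derivative_sum, Finset.mul_sum]
    have e1 : ∀ i, X * (X - 1) *
        derivative (C (diffZeroPow (i + 1) (j + 1)) * (X * (X - 1 : ℝ[X]) ^ (i + 1)))
        = C (((i : ℝ) + 2) * diffZeroPow (i + 1) (j + 1)) * (X * (X - 1) ^ (i + 2))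
          + C (((i : ℝ) + 1) * diffZeroPow (i + 1) (j + 1)) * (X * (X - 1) ^ (i + 1)) := by
      intro i
      rw [derivative_C_mul, mul_left_comm, hθ, C_mul, C_mul]
      ring
    have e2 : ∀ i, C (diffZeroPow (i + 1) (j + 1 + 1)) * (X * (X - 1 : ℝ[X]) ^ (i + 1))
        = C (((i : ℝ) + 1) * diffZeroPow (i + 1) (j + 1)) * (X * (X - 1) ^ (i + 1))
          + C (((i : ℝ) + 1) * diffZeroPow i (j + 1)) * (X * (X - 1) ^ (i + 1)) := by
      intro i
      rw [diffZeroPow_succ, mul_add, C_add, add_mul]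
    simp only [e1, e2, Finset.sum_add_distrib]
    rw [Finset.sum_range_succ (fun i : ℕ =>
      C (((i : ℝ) + 1) * diffZeroPow (i + 1) (j + 1)) * (X * (X - 1 : ℝ[X]) ^ (i + 1))) (j + 1),
      diffZeroPow_eq_zero j (j + 1) (by omega), Finset.sum_range_succ' (fun i : ℕ =>
      C (((i : ℝ) + 1) * diffZeroPow i (j + 1)) * (X * (X - 1 : ℝ[X]) ^ (i + 1)))]
    have e3 : diffZeroPow 0 (j + 1) = 0 := by simp [diffZeroPow]
    rw [e3]
    simp only [mul_zero, map_zero, zero_mul, add_zero]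
    rw [add_comm]
    congr 1
    refine Finset.sum_congr rfl fun i _ => ?_
    push_cast
    rw [show (i : ℝ) + 1 + 1 = i + 2 by ring]

/-- The linear functional that sends `X ^ j` to the value of `A_j` at `u`. -/
theorem exists_umbral_functional (u : ℝ) :
    ∃ L : ℝ[X] →ₗ[ℝ] ℝ, ∀ j, L (X ^ j) = (A j).eval u := by
  refine ⟨(basisMonomials ℝ).constr ℝ fun j => (A j).eval u, fun j => ?_⟩
  have := (basisMonomials ℝ).constr_basis ℝ (fun j => (A j).eval u) j
  simpa [← monomial_one_right_eq_X_pow] using this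

theorem umbral_expand {L : ℝ[X] →ₗ[ℝ] ℝ} {u : ℝ} (hL : ∀ j, L (X ^ j) = (A j).eval u)
    (n : ℕ) (y : ℝ) :
    L ((C y - X) ^ n) = ∑ j ∈ Finset.range (n + 1),
      (n.choose j : ℝ) * (-1) ^ j * (A j).eval u * y ^ (n - j) := by
  rw [sub_eq_neg_add, add_pow, map_sum]
  refine Finset.sum_congr rfl fun j _ => ?_
  have : (-X : ℝ[X]) ^ j * C y ^ (n - j) * (n.choose j : ℝ[X])
      = ((-1) ^ j * y ^ (n - j) * (n.choose j : ℝ)) • X ^ j := by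
    rw [smul_eq_C_mul, neg_pow]
    simp only [map_mul, map_pow, map_neg, map_one, map_natCast]
    ring
  rw [this, map_smul, hL, smul_eq_mul]
  ring

/-- Formally `L p = ∑ lam^l p(l)`, and this splits off the term `l = 0`. Being algebraic, it also
holds for `|lam| > 1`, where the series diverges; this is needed for `lam = 1/q_k`. -/
theorem umbral_shift {L : ℝ[X] →ₗ[ℝ] ℝ} {lam u : ℝ} (hu : u * (1 - lam) = 1)
    (hL : ∀ j, L (X ^ j) = (A j).eval u) (p : ℝ[X]) :
    L p = p.eval 0 + lam * L (p.comp (X + 1)) := by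
  have hu0 : u ≠ 0 := by rintro rfl; simp at hu
  induction p using Polynomial.induction_on' with
  | add p q hp hq => simp only [map_add, add_comp, eval_add]; rw [hp, hq]; ring
  | monomial n c =>
    rw [← C_mul_X_pow_eq_monomial, mul_comp, C_comp, pow_comp, X_comp, ← smul_eq_C_mul,
      ← smul_eq_C_mul, map_smul, map_smul, hL, add_pow, map_sum]
    have h1 := congrArg (eval u) (X_mul_powerSeriesPoly n)
    simp only [eval_mul, eval_X, eval_add, eval_sub, eval_one, eval_finsetSum, eval_natCast] at h1
    have h2 : ∀ i, L (X ^ i * 1 ^ (n - i) * (n.choose i : ℝ[X])) = (n.choose i : ℝ) * (A i).eval u := by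
      intro i
      have : X ^ i * 1 ^ (n - i) * (n.choose i : ℝ[X]) = (n.choose i : ℝ) • (X : ℝ[X]) ^ i := by
        rw [smul_eq_C_mul, map_natCast, one_pow]; ring
      rw [this, map_smul, hL, smul_eq_mul]
    simp only [h2, eval_smul, eval_pow, eval_X, smul_eq_mul]
    have h3 : eval u (if n = 0 then (X : ℝ[X]) else 0) = u * 0 ^ n := by
      split_ifs with h <;> simp [h]
    rw [h3] at h1
    have h4 : u - 1 = u * lam := by linarith
    rw [h4] at h1
    have h5 : (A n).eval u = 0 ^ n + lam * ∑ i ∈ Finset.range (n + 1), (n.choose i : ℝ) * (A i).eval u :=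
      mul_left_cancel₀ hu0 (by linear_combination h1)
    rw [h5]; ring

/-- Closed form of the sums of powers with geometric weights. -/
theorem sum_geom_mul_pow {lam u : ℝ} (hu : u * (1 - lam) = 1) (n β : ℕ) :
    ∑ γ ∈ Finset.range β, lam ^ γ * ((β : ℝ) - γ) ^ n =
      (∑ j ∈ Finset.range (n + 1), (n.choose j : ℝ) * (-1) ^ j * (A j).eval u * (β : ℝ) ^ (n - j))
        - lam ^ β * ((-1) ^ n * (A n).eval u) := by
  obtain ⟨L, hL⟩ := exists_umbral_functional u
  rw [← umbral_expand hL]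
  -- Both sides satisfy `S (β + 1) = (β + 1)^n + lam * S β`; on the right this is `umbral_shift`.
  induction β with
  | zero =>
    have : (C ((0 : ℕ) : ℝ) - X : ℝ[X]) ^ n = ((-1 : ℝ) ^ n) • X ^ n := by
      rw [smul_eq_C_mul, Nat.cast_zero, C_0, zero_sub, neg_pow]; simp
    rw [this, map_smul, hL]
    simp
  | succ β ih =>
    rw [Finset.sum_range_succ']
    have e : ∀ γ ∈ Finset.range β, lam ^ (γ + 1) * (((β + 1 : ℕ) : ℝ) - ((γ + 1 : ℕ) : ℝ)) ^ n
        = lam * (lam ^ γ * ((β : ℝ) - γ) ^ n) := by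
      intro γ _; push_cast; ring
    rw [Finset.sum_congr rfl e, ← Finset.mul_sum, ih, umbral_shift hu hL ((C ((β + 1 : ℕ) : ℝ) - X) ^ n)]
    have e2 : ((C ((β + 1 : ℕ) : ℝ) - X : ℝ[X]) ^ n).comp (X + 1) = (C (β : ℝ) - X) ^ n := by
      rw [pow_comp, sub_comp, C_comp, X_comp]; congr 1; push_cast; simp
    rw [e2]
    simp
    ring

/-- Reversing the order gives the powers from `1` to `β`, hence the Bernoulli numbers with `B_1 =
+1/2`. -/
theorem sum_pow_faulhaber (n β : ℕ) :
    ∑ γ ∈ Finset.range β, ((β : ℝ) - γ) ^ n = (β : ℝ) ^ (n + 1) / (n + 1) +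
      ∑ j ∈ Finset.range n, (n.choose j : ℝ) * ((bernoulli' (j + 1) : ℝ) / (j + 1))
        * (β : ℝ) ^ (n - j) := by
  have h1 : ∑ γ ∈ Finset.range β, ((β : ℝ) - γ) ^ n = ∑ k ∈ Finset.Ico 1 (β + 1), (k : ℝ) ^ n := by
    rw [Finset.sum_Ico_eq_sum_range, ← Finset.sum_range_reflect]
    refine Finset.sum_congr rfl fun γ hγ => ?_
    have : γ < β := Finset.mem_range.1 hγ
    congr 1
    rw [Nat.cast_sub (by omega), Nat.cast_sub (by omega)]
    push_cast; ring
  have h2 := congrArg (Rat.cast : ℚ → ℝ) (sum_Ico_pow β n)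
  push_cast at h2
  rw [h1, h2, Finset.sum_range_succ']
  rw [add_comm]
  congr 1
  · simp
  · refine Finset.sum_congr rfl fun j hj => ?_
    have h3 : ((n : ℝ) + 1) * n.choose j = (n + 1).choose (j + 1) * (j + 1) := by
      exact_mod_cast Nat.add_one_mul_choose_eq n j
    have h4 : n + 1 - (j + 1) = n - j := by omega
    rw [h4]
    have h5 : (n : ℝ) + 1 ≠ 0 := by positivity
    have h6 : (j : ℝ) + 1 ≠ 0 := by positivity
    field_simp
    linear_combination (-(bernoulli' (j + 1) : ℝ) * (β : ℝ) ^ (n - j)) * h3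

end PowerSeriesPoly
/-! ### Sums with the explicit coefficients -/

section Coefficients

variable {ι : Type*} [Fintype ι]

/-- The coefficients for step one; the optimal formula has `κ = 1`. -/
noncomputable def unitCoeff (N : ℕ) (κ : ℝ) (q d : ι → ℝ) (β : ℕ) : ℝ :=
  if β = 0 ∨ β = N then κ / 2 - ∑ k, d k * ((q k - q k ^ N) / (1 - q k))
  else κ + ∑ k, d k * (q k ^ β + q k ^ (N - β))

/-- The weighted power sums that the linear system prescribes. -/
noncomputable def weightedEval (N : ℕ) (q d : ι → ℝ) (j : ℕ) : ℝ :=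
  ∑ k, d k * ((powerSeriesPoly j).eval (1 / (1 - q k))
    + q k ^ N * (powerSeriesPoly j).eval (1 - 1 / (1 - q k)))

variable {N : ℕ} {κ : ℝ} {q d : ι → ℝ}

theorem weightedEval_zero :
    weightedEval N q d 0 = ∑ k, d k * (1 / (1 - q k) + q k ^ N * (1 - 1 / (1 - q k))) := by
  simp [weightedEval, powerSeriesPoly]

theorem sum_unitCoeff_mul_pow (hq0 : ∀ k, q k ≠ 0) (hq1 : ∀ k, q k ≠ 1) (n : ℕ) {β : ℕ}
    (hβ1 : 1 ≤ β) (hβ : β ≤ N) :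
    ∑ γ ∈ Finset.range β, unitCoeff N κ q d γ * ((β : ℝ) - γ) ^ n =
      κ * ((β : ℝ) ^ (n + 1) / (n + 1))
      + ∑ j ∈ Finset.range n, (n.choose j : ℝ)
          * (κ * ((bernoulli' (j + 1) : ℝ) / (j + 1)) + (-1) ^ j * weightedEval N q d j)
          * (β : ℝ) ^ (n - j)
      + (-1) ^ n * weightedEval N q d n
      - (-1) ^ n * ∑ k, d k * (q k ^ β * (powerSeriesPoly n).eval (1 / (1 - q k))
          + q k ^ (N - β) * (powerSeriesPoly n).eval (1 - 1 / (1 - q k)))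
      - (κ / 2 + weightedEval N q d 0) * (β : ℝ) ^ n := by
  have hu : ∀ k, 1 / (1 - q k) * (1 - q k) = 1 := fun k =>
    one_div_mul_cancel (sub_ne_zero.2 (hq1 k).symm)
  have hu' : ∀ k, (1 - 1 / (1 - q k)) * (1 - (q k)⁻¹) = 1 := fun k => by
    have h1 : 1 - q k ≠ 0 := sub_ne_zero.2 (hq1 k).symm
    have h2 := hq0 k
    field_simp
    ring
  -- Extend the interior formula to `γ = 0`. The end coefficient is such that the correction is `κ /
  -- 2 + weightedEval N q d 0`, exactly the coefficient of `β^n` that the term `j = 0` contributes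
  -- when `n ≥ 1`.
  have hfull : ∀ γ ∈ Finset.range β, unitCoeff N κ q d γ * ((β : ℝ) - γ) ^ n =
      κ * ((β : ℝ) - γ) ^ n + ∑ k, d k * (q k ^ γ * ((β : ℝ) - γ) ^ n
        + q k ^ N * ((q k)⁻¹ ^ γ * ((β : ℝ) - γ) ^ n))
      - (if γ = 0 then (κ / 2 + weightedEval N q d 0) * (β : ℝ) ^ n else 0) := by
    intro γ hγ
    have hγ' := Finset.mem_range.1 hγ
    have e1 : ∀ k, q k ^ (N - γ) = q k ^ N * (q k)⁻¹ ^ γ := fun k => by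
      rw [pow_sub₀ _ (hq0 k) (by omega), inv_pow]
    rcases Nat.eq_zero_or_pos γ with rfl | hpos
    · have e2 : (∑ k, d k * (q k ^ 0 * ((β : ℝ) - (0 : ℕ)) ^ n
          + q k ^ N * ((q k)⁻¹ ^ 0 * ((β : ℝ) - (0 : ℕ)) ^ n)))
          = (∑ k, d k * (1 + q k ^ N)) * (β : ℝ) ^ n := by
        rw [Finset.sum_mul]
        refine Finset.sum_congr rfl fun k _ => ?_
        simp; ring
      have e3 : ∑ k, d k * (1 + q k ^ N) = weightedEval N q d 0
          - ∑ k, d k * ((q k - q k ^ N) / (1 - q k)) := by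
        rw [weightedEval_zero, ← Finset.sum_sub_distrib]
        refine Finset.sum_congr rfl fun k _ => ?_
        have h1 : 1 - q k ≠ 0 := sub_ne_zero.2 (hq1 k).symm
        field_simp
        ring
      rw [unitCoeff, if_pos (Or.inl rfl), if_pos rfl, e2, e3]
      simp; ring
    · rw [unitCoeff, if_neg (by omega), if_neg (by omega), sub_zero, add_mul, Finset.sum_mul]
      congr 1
      refine Finset.sum_congr rfl fun k _ => ?_
      rw [e1]; ring
  rw [Finset.sum_congr rfl hfull, Finset.sum_sub_distrib, Finset.sum_add_distrib,
    ← Finset.mul_sum, sum_pow_faulhaber, Finset.sum_comm, Finset.sum_ite_eq' (Finset.range β) 0,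
    if_pos (Finset.mem_range.2 hβ1)]
  congr 1
  have hsum : ∀ k, ∑ γ ∈ Finset.range β, d k * (q k ^ γ * ((β : ℝ) - γ) ^ n
        + q k ^ N * ((q k)⁻¹ ^ γ * ((β : ℝ) - γ) ^ n))
      = ∑ j ∈ Finset.range (n + 1), ((n.choose j : ℝ) * (-1) ^ j * (β : ℝ) ^ (n - j)) * (d k *
          ((powerSeriesPoly j).eval (1 / (1 - q k))
          + q k ^ N * (powerSeriesPoly j).eval (1 - 1 / (1 - q k))))
        - (-1) ^ n * (d k * (q k ^ β * (powerSeriesPoly n).eval (1 / (1 - q k))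
          + q k ^ (N - β) * (powerSeriesPoly n).eval (1 - 1 / (1 - q k)))) := by
    intro k
    rw [← Finset.mul_sum, Finset.sum_add_distrib, ← Finset.mul_sum, sum_geom_mul_pow (hu k),
      sum_geom_mul_pow (hu' k), pow_sub₀ _ (hq0 k) hβ, inv_pow]
    have : ∀ j ∈ Finset.range (n + 1), ((n.choose j : ℝ) * (-1) ^ j * (β : ℝ) ^ (n - j)) * (d k *
          ((powerSeriesPoly j).eval (1 / (1 - q k))
          + q k ^ N * (powerSeriesPoly j).eval (1 - 1 / (1 - q k))))
        = d k * ((n.choose j : ℝ) * (-1) ^ j * (powerSeriesPoly j).eval (1 / (1 - q k))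
            * (β : ℝ) ^ (n - j))
          + d k * q k ^ N * ((n.choose j : ℝ) * (-1) ^ j
            * (powerSeriesPoly j).eval (1 - 1 / (1 - q k)) * (β : ℝ) ^ (n - j)) :=
      fun j _ => by ring
    rw [Finset.sum_congr rfl this, Finset.sum_add_distrib, ← Finset.mul_sum, ← Finset.mul_sum]
    ring
  simp_rw [hsum]
  rw [Finset.sum_sub_distrib, Finset.sum_comm, ← Finset.mul_sum]
  simp_rw [← Finset.mul_sum]
  rw [Finset.sum_range_succ]
  have hw : ∀ j, ∑ k, d k * ((powerSeriesPoly j).eval (1 / (1 - q k))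
          + q k ^ N * (powerSeriesPoly j).eval (1 - 1 / (1 - q k))) = weightedEval N q d j :=
    fun j => rfl
  simp_rw [hw]
  have hsplit : ∑ j ∈ Finset.range n, (n.choose j : ℝ)
          * (κ * ((bernoulli' (j + 1) : ℝ) / (j + 1)) + (-1) ^ j * weightedEval N q d j)
          * (β : ℝ) ^ (n - j)
      = κ * ∑ j ∈ Finset.range n, (n.choose j : ℝ) * ((bernoulli' (j + 1) : ℝ) / (j + 1))
          * (β : ℝ) ^ (n - j)
        + ∑ j ∈ Finset.range n, (n.choose j : ℝ) * (-1) ^ j * (β : ℝ) ^ (n - j)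
          * weightedEval N q d j := by
    rw [Finset.mul_sum, ← Finset.sum_add_distrib]
    exact Finset.sum_congr rfl fun j _ => by ring
  rw [hsplit]
  simp
  ring

theorem sum_unitCoeff (hN : 1 ≤ N) (hq0 : ∀ k, q k ≠ 0) (hq1 : ∀ k, q k ≠ 1) :
    ∑ γ ∈ Finset.range (N + 1), unitCoeff N κ q d γ = κ * N := by
  have h := sum_unitCoeff_mul_pow (κ := κ) (d := d) hq0 hq1 0 hN le_rfl
  simp only [pow_zero, mul_one] at h
  rw [Finset.sum_range_succ, h, unitCoeff, if_pos (Or.inr rfl)]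
  have e : ∑ k, d k * (q k ^ N * (powerSeriesPoly 0).eval (1 / (1 - q k))
        + q k ^ (N - N) * (powerSeriesPoly 0).eval (1 - 1 / (1 - q k)))
      = - ∑ k, d k * ((q k - q k ^ N) / (1 - q k)) := by
    rw [← Finset.sum_neg_distrib]
    refine Finset.sum_congr rfl fun k _ => ?_
    have h1 : 1 - q k ≠ 0 := sub_ne_zero.2 (hq1 k).symm
    simp [powerSeriesPoly]
    field_simp
    ring
  rw [e]
  simp
  ring

theorem weightedEval_reflect (j : ℕ) :
    ∑ k, d k * (q k ^ N * (powerSeriesPoly (j + 1)).eval (1 / (1 - q k))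
        + (powerSeriesPoly (j + 1)).eval (1 - 1 / (1 - q k)))
      = (-1) ^ j * weightedEval N q d (j + 1) := by
  rw [weightedEval, Finset.mul_sum]
  refine Finset.sum_congr rfl fun k _ => ?_
  rw [powerSeriesPoly_eval_one_sub]
  have : ((-1 : ℝ) ^ j) * (-1) ^ j = 1 := by rw [← mul_pow]; simp
  linear_combination (-(d k * q k ^ N * (powerSeriesPoly (j + 1)).eval (1 / (1 - q k)))) * this

/-- The linear system in terms of the polynomials `A_j`. -/
def SolvesUnitSystem (m N : ℕ) (κ : ℝ) (q d : ι → ℝ) : Prop :=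
  ∀ j, 1 ≤ j → j < m →
    weightedEval N q d j = (-1) ^ (j + 1) * (κ * ((bernoulli' (j + 1) : ℝ) / (j + 1)))

/-- At `β = N` the term `j = 0` cancels against the end correction and the system removes those with
`1 ≤ j < n`. The constant terms cancel by the reflection `β ↦ N - β`, up to a parity case settled by
the vanishing of odd Bernoulli numbers. -/
theorem moment_unitCoeff {m : ℕ} (hN : 1 ≤ N) (hq0 : ∀ k, q k ≠ 0) (hq1 : ∀ k, q k ≠ 1)
    (hs : SolvesUnitSystem m N κ q d) {n : ℕ} (hn : n < m) :
    ∑ γ ∈ Finset.range (N + 1), unitCoeff N κ q d γ * ((N : ℝ) - γ) ^ n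
      = κ * ((N : ℝ) ^ (n + 1) / (n + 1)) := by
  rcases Nat.eq_zero_or_pos n with rfl | hpos
  · simp [sum_unitCoeff hN hq0 hq1]
  · obtain ⟨n, rfl⟩ : ∃ n', n = n' + 1 := ⟨n - 1, by omega⟩
    rw [Finset.sum_range_succ, sub_self, zero_pow (by omega), mul_zero, add_zero,
      sum_unitCoeff_mul_pow hq0 hq1 (n + 1) hN le_rfl, Nat.sub_self]
    simp only [pow_zero, one_mul]
    rw [weightedEval_reflect, Finset.sum_range_succ']
    have e : ∀ j ∈ Finset.range n, ((n + 1).choose (j + 1) : ℝ)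
          * (κ * ((bernoulli' (j + 1 + 1) : ℝ) / ((j + 1 : ℕ) + 1))
            + (-1) ^ (j + 1) * weightedEval N q d (j + 1))
          * (N : ℝ) ^ (n + 1 - (j + 1)) = 0 := by
      intro j hj
      have hj' := Finset.mem_range.1 hj
      rw [hs (j + 1) (by omega) (by omega), pow_succ _ (j + 1)]
      have : ((-1 : ℝ) ^ (j + 1)) * (-1) ^ (j + 1) = 1 := by rw [← mul_pow]; simp
      linear_combination (-(((n + 1).choose (j + 1) : ℝ) *
        (κ * ((bernoulli' (j + 1 + 1) : ℝ) / ((j + 1 : ℕ) + 1))) * (N : ℝ) ^ (n + 1 - (j + 1)))) * this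
    rw [Finset.sum_eq_zero e]
    have hodd : (-1 : ℝ) ^ (n + 1) * weightedEval N q d (n + 1)
        - (-1) ^ (n + 1) * ((-1) ^ n * weightedEval N q d (n + 1)) = 0 := by
      rcases Nat.even_or_odd n with he | ho
      · rw [he.neg_one_pow]; ring
      · rw [hs (n + 1) (by omega) hn, bernoulli'_eq_zero_of_odd (by
          obtain ⟨r, rfl⟩ := ho; exact ⟨r + 1, by ring⟩) (by omega)]
        simp
    simp
    linear_combination hodd

open Polynomial in
/-- The polynomial part of the spline with step one. -/
noncomputable def unitPoly (m N : ℕ) (κ : ℝ) (q d : ι → ℝ) : ℝ[X] :=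
  ∑ j ∈ Finset.Ico m (2 * m - 1), C (((2 * m - 1).choose j : ℝ)
    * (κ * ((bernoulli' (j + 1) : ℝ) / (j + 1)) + (-1) ^ j * weightedEval N q d j))
    * X ^ (2 * m - 1 - j)

theorem natDegree_unitPoly_lt {m : ℕ} (hm : 1 ≤ m) : (unitPoly m N κ q d).natDegree < m := by
  refine lt_of_le_of_lt (Polynomial.natDegree_sum_le_of_forall_le (n := m - 1) _ _ fun j hj => ?_)
    (by omega)
  have := Finset.mem_Ico.1 hj
  exact (Polynomial.natDegree_C_mul_X_pow_le _ _).trans (by omega)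

/-- Because `A_{2m-1}` vanishes at `1/(1 - q_k)` and at its reflection, no power of `q_k` depending
on `β` survives. The end correction removes `j = 0`, the system removes `1 ≤ j < m`, and `unitPoly`
collects the rest. -/
theorem spline_vanish_unit {m : ℕ} (hm : 1 ≤ m) (hq0 : ∀ k, q k ≠ 0)
    (hq1 : ∀ k, q k ≠ 1) (hroot : ∀ k, (powerSeriesPoly (2 * m - 1)).eval (1 / (1 - q k)) = 0)
    (hs : SolvesUnitSystem m N κ q d) {β : ℕ} (hβ : β ≤ N) :
    ∑ γ ∈ Finset.range β, unitCoeff N κ q d γ * ((β : ℝ) - γ) ^ (2 * m - 1)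
      = κ * ((β : ℝ) ^ (2 * m) / (2 * m)) + (unitPoly m N κ q d).eval (β : ℝ) := by
  have hroot' : ∀ k, (powerSeriesPoly (2 * m - 1)).eval (1 - 1 / (1 - q k)) = 0 := by
    intro k
    have h := powerSeriesPoly_eval_one_sub (2 * m - 2) (1 / (1 - q k))
    rw [show 2 * m - 2 + 1 = 2 * m - 1 by omega, hroot, mul_zero] at h
    exact h
  rcases Nat.eq_zero_or_pos β with rfl | hpos
  · have : (unitPoly m N κ q d).eval ((0 : ℕ) : ℝ) = 0 := by
      rw [unitPoly, Polynomial.eval_finsetSum]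
      refine Finset.sum_eq_zero fun j hj => ?_
      have := Finset.mem_Ico.1 hj
      simp [show 2 * m - 1 - j ≠ 0 by omega]
    rw [this]
    simp [show m ≠ 0 by omega]
  · rw [sum_unitCoeff_mul_pow hq0 hq1 _ hpos hβ]
    have h0 : weightedEval N q d (2 * m - 1) = 0 := by
      simp only [weightedEval, hroot, hroot', mul_zero, add_zero, Finset.sum_const_zero]
    simp only [h0, hroot, hroot', mul_zero, add_zero, Finset.sum_const_zero, sub_zero]
    have hsplit : ∑ j ∈ Finset.range (2 * m - 1), ((2 * m - 1).choose j : ℝ)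
          * (κ * ((bernoulli' (j + 1) : ℝ) / (j + 1)) + (-1) ^ j * weightedEval N q d j)
          * (β : ℝ) ^ (2 * m - 1 - j)
        = (κ / 2 + weightedEval N q d 0) * (β : ℝ) ^ (2 * m - 1)
          + (unitPoly m N κ q d).eval (β : ℝ) := by
      rw [Finset.range_eq_Ico, ← Finset.sum_Ico_consecutive _ (Nat.zero_le m)
        (by omega : m ≤ 2 * m - 1)]
      congr 1
      · rw [Finset.sum_eq_sum_Ico_succ_bot hm, Finset.sum_eq_zero]
        · simp only [Nat.choose_zero_right, Nat.cast_one, pow_zero, one_mul, zero_add,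
            Nat.cast_zero, Nat.sub_zero, bernoulli'_one]
          push_cast
          ring
        · intro j hj
          have hj' := Finset.mem_Ico.1 hj
          rw [hs j (by omega) hj'.2, pow_succ]
          have : ((-1 : ℝ) ^ j) * (-1) ^ j = 1 := by rw [← mul_pow]; simp
          linear_combination (-(((2 * m - 1).choose j : ℝ) *
            (κ * ((bernoulli' (j + 1) : ℝ) / (j + 1))) * (β : ℝ) ^ (2 * m - 1 - j))) * this
      · rw [unitPoly, Polynomial.eval_finsetSum]
        exact Finset.sum_congr rfl fun j _ => by simp
    rw [hsplit, show 2 * m - 1 + 1 = 2 * m by omega]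
    have : ((2 * m - 1 : ℕ) : ℝ) + 1 = 2 * m := by
      rw [Nat.cast_sub (by omega)]; push_cast; ring
    rw [this]
    ring

end Coefficients
/-! ### Optimality of the explicit coefficients and solvability of the system -/

section Scaling

variable {ι : Type*} [Fintype ι] {m N : ℕ} {κ : ℝ} {q d : ι → ℝ}

theorem sum_truncPow_nodes (f : ℕ → ℝ) {h a : ℝ} (hh : 0 < h) {n : ℕ} (hn : n ≠ 0)
    (β : Fin (N + 1)) :
    ∑ γ : Fin (N + 1), f γ * truncPow n (h * (γ : ℝ) + a) (h * (β : ℝ) + a)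
      = h ^ n / n.factorial * ∑ γ ∈ Finset.range β, f γ * (((β : ℕ) : ℝ) - γ) ^ n := by
  rw [Fin.sum_univ_eq_sum_range (fun γ => f γ * truncPow n (h * (γ : ℝ) + a) (h * (β : ℝ) + a)),
    Finset.mul_sum]
  symm
  apply Finset.sum_subset_zero_on_sdiff
  · intro γ hγ
    have := Finset.mem_range.1 hγ
    have := β.2
    exact Finset.mem_range.2 (by omega)
  · intro γ hγ
    have h1 : (β : ℕ) ≤ γ := by simpa using (Finset.mem_sdiff.1 hγ).2
    rcases h1.lt_or_eq with h2 | h2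
    · have h3 : ((β : ℕ) : ℝ) < γ := by exact_mod_cast h2
      rw [truncPow, if_neg (by nlinarith), mul_zero]
    · rw [← h2]; simp [truncPow, hn]
  · intro γ hγ
    have h2 : (γ : ℝ) < ((β : ℕ) : ℝ) := by exact_mod_cast Finset.mem_range.1 hγ
    rw [truncPow, if_pos (by nlinarith),
      show h * ((β : ℕ) : ℝ) + a - (h * (γ : ℝ) + a) = h * (((β : ℕ) : ℝ) - γ) by ring, mul_pow]
    ring

open Polynomial in
/-- The polynomial part of the spline with step `h` and left end point `a`. -/
noncomputable def scaledPoly (m N : ℕ) (κ h a : ℝ) (q d : ι → ℝ) : ℝ[X] :=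
  -- Of the `2m` factors `h`, one belongs to the coefficients and `2m - 1` to the truncated powers.
  (C (h ^ (2 * m) / (2 * m - 1).factorial) * unitPoly m N κ q d).comp (C h⁻¹ * (X - C a))

theorem iterate_derivative_scaledPoly (hm : 1 ≤ m) (h a : ℝ) :
    Polynomial.derivative^[m] (scaledPoly m N κ h a q d) = 0 := by
  apply Polynomial.iterate_derivative_eq_zero
  have h1 := natDegree_unitPoly_lt (N := N) (κ := κ) (q := q) (d := d) hm
  have h2 := Polynomial.natDegree_comp_le
    (p := Polynomial.C (h ^ (2 * m) / (2 * m - 1).factorial) * unitPoly m N κ q d)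
    (q := Polynomial.C h⁻¹ * (Polynomial.X - Polynomial.C a))
  have h3 := Polynomial.natDegree_C_mul_le (h ^ (2 * m) / (2 * m - 1).factorial)
    (unitPoly m N κ q d)
  have h4 := Polynomial.natDegree_C_mul_le h⁻¹ (Polynomial.X - Polynomial.C a)
  rw [Polynomial.natDegree_X_sub_C] at h4
  exact lt_of_le_of_lt (h2.trans (Nat.mul_le_mul h3 h4)) (by omega)

theorem spline_vanish (hm : 1 ≤ m) (hq0 : ∀ k, q k ≠ 0)
    (hq1 : ∀ k, q k ≠ 1) (hroot : ∀ k, (powerSeriesPoly (2 * m - 1)).eval (1 / (1 - q k)) = 0)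
    (hs : SolvesUnitSystem m N κ q d) {h a : ℝ} (hh : 0 < h) (β : Fin (N + 1)) :
    spline m a κ (scaledPoly m N κ h a q d) (fun β : Fin (N + 1) => h * (β : ℝ) + a)
      (fun β => h * unitCoeff N κ q d β) 0 (h * (β : ℝ) + a) = 0 := by
  have h1 := spline_vanish_unit hm hq0 hq1 hroot hs (Nat.lt_succ_iff.1 β.2)
  have hp : (scaledPoly m N κ h a q d).eval (h * (β : ℝ) + a)
      = h ^ (2 * m) / (2 * m - 1).factorial * (unitPoly m N κ q d).eval ((β : ℕ) : ℝ) := by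
    rw [scaledPoly, Polynomial.eval_comp, Polynomial.eval_mul, Polynomial.eval_C]
    congr 2
    simp only [Polynomial.eval_mul, Polynomial.eval_C, Polynomial.eval_sub, Polynomial.eval_X]
    field_simp
    ring
  rw [spline, Function.iterate_zero_apply, hp, Nat.sub_zero, Nat.sub_zero]
  have h2 := sum_truncPow_nodes (N := N) (fun γ => h * unitCoeff N κ q d γ) hh (a := a)
    (n := 2 * m - 1) (by omega) β
  rw [h2]
  have h3 : ∑ γ ∈ Finset.range β, h * unitCoeff N κ q d γ * (((β : ℕ) : ℝ) - γ) ^ (2 * m - 1)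
      = h * (κ * ((((β : ℕ) : ℝ)) ^ (2 * m) / (2 * m))
        + (unitPoly m N κ q d).eval ((β : ℕ) : ℝ)) := by
    rw [← h1, Finset.mul_sum]
    exact Finset.sum_congr rfl fun γ _ => by ring
  rw [h3]
  obtain ⟨n, hn⟩ : ∃ n, 2 * m = n + 1 := ⟨2 * m - 1, by omega⟩
  have hn' : 2 * (m : ℝ) = n + 1 := by exact_mod_cast hn
  have hf : ((n.factorial : ℕ) : ℝ) ≠ 0 := by positivity
  have hn0 : (n : ℝ) + 1 ≠ 0 := by positivity
  rw [hn', hn, Nat.add_sub_cancel, Nat.factorial_succ]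
  push_cast
  field_simp
  ring

theorem moment_scaled (hN : 1 ≤ N) (hq0 : ∀ k, q k ≠ 0) (hq1 : ∀ k, q k ≠ 1)
    (hs : SolvesUnitSystem m N κ q d) (h a : ℝ) {j : ℕ} (hj : j < m) :
    κ * ((h * N) ^ (j + 1) / (j + 1).factorial) = ∑ β : Fin (N + 1), h * unitCoeff N κ q d β
      * ((h * N + a - (h * (β : ℝ) + a)) ^ j / j.factorial) := by
  have h1 := moment_unitCoeff hN hq0 hq1 hs hj
  rw [← Fin.sum_univ_eq_sum_range (fun γ => unitCoeff N κ q d γ * ((N : ℝ) - γ) ^ j)] at h1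
  have h2 : ∀ β : Fin (N + 1), h * unitCoeff N κ q d β
      * ((h * N + a - (h * (β : ℝ) + a)) ^ j / j.factorial)
      = h ^ (j + 1) / j.factorial * (unitCoeff N κ q d β * ((N : ℝ) - (β : ℕ)) ^ j) := by
    intro β
    rw [show h * N + a - (h * (β : ℝ) + a) = h * ((N : ℝ) - (β : ℕ)) by ring, mul_pow]
    ring
  simp_rw [h2]
  rw [← Finset.mul_sum, h1, Nat.factorial_succ]
  have : ((j.factorial : ℕ) : ℝ) ≠ 0 := by positivity
  push_cast
  field_simp
  ring

/-- The homogeneous system prescribes zeros only for `j < m`. The others are read off from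
`unitPoly`, whose coefficients for `m ≤ j ≤ 2m - 2` are nonzero multiples of these values, once the
associated spline has no jumps. -/
theorem weightedEval_eq_zero (hm : 1 ≤ m) (hN : 1 ≤ N) (hmN : m ≤ N + 1) (hq0 : ∀ k, q k ≠ 0)
    (hq1 : ∀ k, q k ≠ 1) (hroot : ∀ k, (powerSeriesPoly (2 * m - 1)).eval (1 / (1 - q k)) = 0)
    (hs : SolvesUnitSystem m N 0 q d) {j : ℕ} (hj1 : 1 ≤ j) (hj : j ≤ 2 * m - 2) :
    weightedEval N q d j = 0 := by
  have hN0 : (0 : ℝ) < N := by exact_mod_cast hN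
  have hC : ∀ γ : Fin (N + 1), 1 * unitCoeff N 0 q d γ = 0 := by
    refine coeff_eq_zero_of_vanish (a := 0) (b := N) (x := fun β : Fin (N + 1) => 1 * (β : ℝ) + 0)
      (C := fun γ => 1 * unitCoeff N 0 q d γ) hm hN0
      (iterate_derivative_scaledPoly (N := N) (κ := 0) (q := q) (d := d) hm 1 0) ?_ ?_ ?_
      (spline_vanish hm hq0 hq1 hroot hs one_pos)
    · intro β
      have : (β : ℝ) ≤ N := by exact_mod_cast Nat.lt_succ_iff.1 β.2
      simp [this]
    · intro β γ hβγ
      simp only [one_mul, add_zero] at hβγ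
      exact Fin.ext (by exact_mod_cast hβγ)
    · intro j hj
      have := moment_scaled hN hq0 hq1 hs 1 0 hj
      simpa using this.symm
  have hzero : ∀ β : Fin (N + 1), (unitPoly m N 0 q d).eval (β : ℝ) = 0 := by
    intro β
    have h1 := spline_vanish_unit hm hq0 hq1 hroot hs (Nat.lt_succ_iff.1 β.2)
    rw [Finset.sum_eq_zero, zero_mul, zero_add] at h1
    · exact h1.symm
    · intro γ hγ
      have := Finset.mem_range.1 hγ
      have h2 := hC ⟨γ, by omega⟩
      rw [one_mul] at h2
      simp only at h2
      rw [h2, zero_mul]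
  -- A polynomial of degree less than `m` with `N + 1` zeros; this is where `m ≤ N + 1` enters.
  have hpoly : unitPoly m N 0 q d = 0 := by
    refine Polynomial.eq_zero_of_natDegree_lt_card_of_eval_eq_zero _
      (f := fun β : Fin (N + 1) => (β : ℝ)) ?_ hzero ?_
    · intro β γ hβγ
      simp only at hβγ
      exact Fin.ext (by exact_mod_cast hβγ)
    · have := natDegree_unitPoly_lt (N := N) (κ := 0) (q := q) (d := d) hm
      simp; omega
  rcases lt_or_ge j m with h | h
  · rw [hs j hj1 h]; simp
  · have h1 := congrArg (fun p => p.coeff (2 * m - 1 - j)) hpoly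
    simp only [unitPoly, Polynomial.finsetSum_coeff, Polynomial.coeff_C_mul_X_pow,
      Polynomial.coeff_zero] at h1
    rw [Finset.sum_eq_single j] at h1
    · rw [if_pos rfl] at h1
      have h2 : ((2 * m - 1).choose j : ℝ) ≠ 0 := by
        exact_mod_cast (Nat.choose_pos (by omega)).ne'
      simpa [h2] using h1
    · intro i hi hij
      have := Finset.mem_Ico.1 hi
      rw [if_neg (by omega)]
    · intro hj'
      exact absurd (Finset.mem_Ico.2 ⟨h, by omega⟩) hj'

end Scaling

/-! ### Linear independence of the values of the generating polynomials -/

open Polynomial in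
-- Solve the formula for `X (X - 1) d/dX` applied to `X (X - 1)^(i+1)` for its top term; the
-- operator raises the index of each `A_j` by one.
theorem X_mul_pow_mem_span (i : ℕ) :
    X * (X - 1) ^ (i + 1) ∈ Submodule.span ℝ (powerSeriesPoly '' Icc 1 (i + 1)) := by
  induction i with
  | zero =>
    apply Submodule.subset_span
    exact ⟨1, by simp, by simp [powerSeriesPoly]⟩
  | succ i ih =>
    let θ : ℝ[X] →ₗ[ℝ] ℝ[X] := LinearMap.mulLeft ℝ (X * (X - 1)) ∘ₗ derivative
    have h1 : θ (X * (X - 1) ^ (i + 1)) ∈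
        Submodule.span ℝ (powerSeriesPoly '' Icc 1 (i + 2)) := by
      have := Submodule.mem_map_of_mem (f := θ) ih
      rw [Submodule.map_span] at this
      refine Submodule.span_mono ?_ this
      rintro _ ⟨_, ⟨j, hj, rfl⟩, rfl⟩
      exact ⟨j + 1, ⟨by omega, by have := hj.2; omega⟩, rfl⟩
    have h2 : X * (X - 1) ^ (i + 1) ∈ Submodule.span ℝ (powerSeriesPoly '' Icc 1 (i + 2)) :=
      Submodule.span_mono (image_mono (Icc_subset_Icc_right (by omega))) ih
    have h3 : X * (X - 1 : ℝ[X]) ^ (i + 2) = ((i : ℝ) + 2)⁻¹ •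
        (θ (X * (X - 1) ^ (i + 1)) - ((i : ℝ) + 1) • (X * (X - 1) ^ (i + 1))) := by
      have h4 : (i : ℝ) + 2 ≠ 0 := by positivity
      rw [eq_inv_smul_iff₀ h4, smul_eq_C_mul, smul_eq_C_mul]
      simp only [θ, LinearMap.comp_apply, LinearMap.mulLeft_apply, derivative_mul, derivative_X,
        derivative_pow, derivative_sub, derivative_one, Nat.add_sub_cancel, Nat.cast_add,
        Nat.cast_one, map_add, map_one, map_natCast, map_ofNat]
      ring
    rw [h3]
    exact Submodule.smul_mem _ _ (Submodule.sub_mem _ h1 (Submodule.smul_mem _ _ h2))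

/-- The functions `j ↦ A_j(v)` for different arguments `v ≠ 0, 1` are linearly independent. -/
theorem eq_zero_of_sum_powerSeriesPoly {ι : Type*} [Fintype ι] {v w : ι → ℝ}
    (hv : Function.Injective v) (hv0 : ∀ k, v k ≠ 0) (hv1 : ∀ k, v k ≠ 1)
    (h : ∀ j, 1 ≤ j → j ≤ Fintype.card ι → ∑ k, w k * (powerSeriesPoly j).eval (v k) = 0) :
    w = 0 := by
  let Φ : Polynomial ℝ →ₗ[ℝ] ℝ := ∑ k, w k • Polynomial.leval (v k)
  have hΦ : ∀ p, Φ p = ∑ k, w k * p.eval (v k) := by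
    intro p; simp [Φ, LinearMap.sum_apply, Polynomial.leval]
  have h1 : ∀ i, i < Fintype.card ι → ∑ k, w k * (v k * (v k - 1)) * (v k - 1) ^ i = 0 := by
    intro i hi
    have h2 : Submodule.span ℝ (powerSeriesPoly '' Icc 1 (i + 1)) ≤ LinearMap.ker Φ := by
      rw [Submodule.span_le]
      rintro _ ⟨j, hj, rfl⟩
      exact (hΦ _).trans (h j hj.1 (by have := hj.2; omega))
    have h3 : Φ (Polynomial.X * (Polynomial.X - 1) ^ (i + 1)) = 0 := h2 (X_mul_pow_mem_span i)
    rw [hΦ] at h3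
    rw [← h3]
    refine Finset.sum_congr rfl fun k _ => ?_
    simp [pow_succ]; ring
  let e := Fintype.equivFin ι
  -- All `A_j` with `j ≥ 1` are divisible by `X (X - 1)`. With this factor absorbed into the
  -- weights, the relations form a Vandermonde system in `v k - 1`.
  have h4 : (fun i => w (e.symm i) * (v (e.symm i) * (v (e.symm i) - 1))) = 0 := by
    refine Matrix.eq_zero_of_forall_pow_sum_mul_pow_eq_zero
      (f := fun i => v (e.symm i) - 1) ?_ fun i => ?_
    · intro i j hij
      exact e.symm.injective (hv (by simpa using hij))
    · rw [← h1 i i.2]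
      exact e.symm.sum_comp (fun k => w k * (v k * (v k - 1)) * (v k - 1) ^ (i : ℕ))
  funext k
  have h5 := congrFun h4 (e k)
  simp only [Equiv.symm_apply_apply, Pi.zero_apply] at h5
  have h6 : v k * (v k - 1) ≠ 0 := mul_ne_zero (hv0 k) (sub_ne_zero.2 (hv1 k))
  exact (mul_eq_zero.1 h5).resolve_right h6

/-! ### Roots of the Euler-Frobenius polynomials -/

/-- Rolle's theorem: `A_{n+1}` also vanishes at `0` and `1`, so its `n + 2` zeros separate `n + 1`
zeros of the derivative, which are zeros of `A_{n+2}`. -/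
theorem exists_roots_powerSeriesPoly (n : ℕ) :
    ∃ S : Finset ℝ, S.card = n ∧ ∀ u ∈ S, 0 < u ∧ u < 1 ∧ (powerSeriesPoly (n + 1)).eval u = 0 := by
  induction n with
  | zero => exact ⟨∅, rfl, by simp⟩
  | succ n ih =>
    obtain ⟨S, hcard, hS⟩ := ih
    have h1 : (1 : ℝ) ∉ S := fun h => (hS 1 h).2.1.ne rfl
    have h0 : (0 : ℝ) ∉ insert 1 S := by
      simp only [Finset.mem_insert, not_or]
      exact ⟨zero_ne_one, fun h => (hS 0 h).1.ne rfl⟩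
    have hcard' : (insert 0 (insert 1 S)).card = n + 2 := by
      rw [Finset.card_insert_of_notMem h0, Finset.card_insert_of_notMem h1, hcard]
    have hT : ∀ u ∈ insert 0 (insert 1 S), 0 ≤ u ∧ u ≤ 1 ∧ (powerSeriesPoly (n + 1)).eval u = 0 := by
      intro u hu
      simp only [Finset.mem_insert] at hu
      rcases hu with rfl | rfl | hu
      · simp [powerSeriesPoly]
      · simp [powerSeriesPoly]
      · exact ⟨(hS u hu).1.le, (hS u hu).2.1.le, (hS u hu).2.2⟩
    let e := (insert 0 (insert 1 S)).orderEmbOfFin hcard'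
    have he : ∀ i, 0 ≤ e i ∧ e i ≤ 1 ∧ (powerSeriesPoly (n + 1)).eval (e i) = 0 :=
      fun i => hT _ (Finset.orderEmbOfFin_mem _ hcard' i)
    have hroll : ∀ i : Fin (n + 1), ∃ c ∈ Ioo (e i.castSucc) (e i.succ),
        deriv (fun x => (powerSeriesPoly (n + 1)).eval x) c = 0 := fun i =>
      exists_deriv_eq_zero (e.strictMono i.castSucc_lt_succ)
        (powerSeriesPoly (n + 1)).continuous.continuousOn
        ((he _).2.2.trans (he _).2.2.symm)
    choose c hc hcd using hroll
    have hmono : StrictMono c := by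
      intro i j hij
      have : e i.succ ≤ e j.castSucc := e.monotone (Fin.succ_le_castSucc_iff.2 hij)
      exact (hc i).2.trans_le (this.trans (hc j).1.le)
    refine ⟨Finset.univ.map ⟨c, hmono.injective⟩, by simp, ?_⟩
    intro u hu
    obtain ⟨i, -, rfl⟩ := Finset.mem_map.1 hu
    refine ⟨(he _).1.trans_lt (hc i).1, (hc i).2.trans_le (he _).2.1, ?_⟩
    have := hcd i
    rw [Polynomial.deriv] at this
    rw [powerSeriesPoly, Polynomial.eval_mul]
    exact mul_eq_zero_of_right _ this

/-- Under `u = 1/(1 - x)` the operator `x d/dx` becomes `u (u - 1) d/du`, so both sides arise from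
`x / (1 - x)²` by the same iteration. -/
theorem powerSeriesPoly_eval_eq (k : ℕ) {x : ℝ} (hx : x ≠ 1) :
    (powerSeriesPoly (k + 1)).eval (1 / (1 - x))
      = x * (eulerFrobenius k).eval x / (1 - x) ^ (k + 2) := by
  rw [← iterate_eval k x hx]
  symm
  induction k generalizing x with
  | zero =>
    have h1 : 1 - x ≠ 0 := sub_ne_zero.2 hx.symm
    simp [powerSeriesPoly]
    field_simp
    ring
  | succ k ih =>
    have h1 : 1 - x ≠ 0 := sub_ne_zero.2 hx.symm
    rw [Function.iterate_succ_apply']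
    have hev : ((fun (f : ℝ → ℝ) (y : ℝ) => y * deriv f y)^[k] (fun y => y / (1 - y) ^ 2))
        =ᶠ[nhds x] fun y => (powerSeriesPoly (k + 1)).eval (1 / (1 - y)) := by
      filter_upwards [isOpen_ne.mem_nhds hx] with y hy using ih hy
    have h2 : HasDerivAt (fun y : ℝ => 1 / (1 - y)) (1 / (1 - x) ^ 2) x := by
      have := ((hasDerivAt_id x).const_sub 1).inv h1
      simpa [one_div] using! this
    have h3 := ((powerSeriesPoly (k + 1)).hasDerivAt (1 / (1 - x))).comp x h2
    show x * deriv _ x = _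
    rw [hev.deriv_eq]
    have h4 := h3.deriv
    simp only [Function.comp_def] at h4
    rw [h4, show powerSeriesPoly (k + 1 + 1) = Polynomial.X * (Polynomial.X - 1) *
      Polynomial.derivative (powerSeriesPoly (k + 1)) from rfl]
    simp only [Polynomial.eval_mul, Polynomial.eval_X, Polynomial.eval_sub, Polynomial.eval_one]
    field_simp
    ring

theorem eulerFrobenius_eval_zero (k : ℕ) : (eulerFrobenius k).eval 0 = 1 := by
  induction k with
  | zero => simp [eulerFrobenius]
  | succ k ih => simp [eulerFrobenius, ih]

theorem natDegree_eulerFrobenius_le (k : ℕ) : (eulerFrobenius k).natDegree ≤ k := by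
  induction k with
  | zero => simp [eulerFrobenius]
  | succ k ih =>
    rw [eulerFrobenius]
    refine Polynomial.natDegree_add_le_of_degree_le ?_ ?_
    · refine Polynomial.natDegree_mul_le.trans ?_
      have : (1 + Polynomial.C ((k : ℝ) + 1) * Polynomial.X).natDegree ≤ 1 := by
        rw [add_comm]
        exact Polynomial.natDegree_linear_le (a := (k : ℝ) + 1) (b := 1)
      omega
    · rcases Nat.eq_zero_or_pos k with rfl | hk
      · simp [eulerFrobenius]
      · refine Polynomial.natDegree_mul_le.trans ?_
        have h1 : (Polynomial.X * (1 - Polynomial.X) : Polynomial ℝ).natDegree ≤ 2 := by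
          compute_degree
        have h2 := Polynomial.natDegree_derivative_le (eulerFrobenius k)
        omega

/-- All complex roots of `E_k` are the numbers `1 - 1 / u`, where `u` runs through the roots of
`A_{k+1}` between zero and one. -/
theorem exists_finset_roots (k : ℕ) :
    ∃ S : Finset ℝ, S.card = k ∧
      (∀ u, u ∈ S ↔ 0 < u ∧ u < 1 ∧ (powerSeriesPoly (k + 1)).eval u = 0) ∧
      ∀ z : ℂ, Polynomial.aeval z (eulerFrobenius k) = 0 ↔
        ∃ u ∈ S, z = ((1 - 1 / u : ℝ) : ℂ) := by
  obtain ⟨S, hcard, hS⟩ := exists_roots_powerSeriesPoly k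
  have hroot : ∀ u : ℝ, 0 < u → u < 1 → (powerSeriesPoly (k + 1)).eval u = 0 →
      (eulerFrobenius k).eval (1 - 1 / u) = 0 := by
    intro u hu0 hu1 hu
    have hx : 1 - 1 / u ≠ 1 := by
      have : 1 / u ≠ 0 := by positivity
      intro h; exact this (by linarith)
    have h := powerSeriesPoly_eval_eq k hx
    have e : 1 / (1 - (1 - 1 / u)) = u := by
      rw [sub_sub_cancel, one_div_one_div]
    rw [e, hu] at h
    have hx0 : 1 - 1 / u ≠ 0 := by
      have : 1 < 1 / u := by rw [lt_div_iff₀ hu0]; linarith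
      linarith
    have h1 : (1 - (1 - 1 / u)) ^ (k + 2) ≠ 0 := pow_ne_zero _ (sub_ne_zero.2 hx.symm)
    rw [eq_comm, div_eq_zero_iff] at h
    exact ((mul_eq_zero.1 (h.resolve_right h1)).resolve_left hx0)
  have haeval : ∀ x : ℝ, Polynomial.aeval (x : ℂ) (eulerFrobenius k)
      = (((eulerFrobenius k).eval x : ℝ) : ℂ) := by
    intro x
    have := Polynomial.aeval_algebraMap_apply ℂ x (eulerFrobenius k)
    simpa using this
  have hall : ∀ z : ℂ, Polynomial.aeval z (eulerFrobenius k) = 0 →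
      ∃ u ∈ S, z = ((1 - 1 / u : ℝ) : ℂ) := by
    intro z hz
    by_contra hne
    push Not at hne
    set f : ℝ → ℂ := fun u => ((1 - 1 / u : ℝ) : ℂ) with hf
    have hinj : Function.Injective f := by
      intro u v huv
      have h1 : (1 - 1 / u : ℝ) = 1 - 1 / v := Complex.ofReal_injective huv
      have h2 : 1 / u = 1 / v := by linarith
      exact inv_injective (by simpa using h2)
    have hznot : z ∉ S.image f := by
      intro h
      obtain ⟨u, hu, rfl⟩ := Finset.mem_image.1 h
      exact hne u hu rfl
    -- A further root would give `k + 1` roots in degree at most `k`, but `E_k(0) = 1`.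
    have hzero := Polynomial.eq_zero_of_natDegree_lt_card_of_eval_eq_zero'
      ((eulerFrobenius k).map (algebraMap ℝ ℂ)) (insert z (S.image f)) ?_ ?_
    · have := congrArg (Polynomial.eval 0) hzero
      rw [← map_zero (algebraMap ℝ ℂ), Polynomial.eval_map_apply, eulerFrobenius_eval_zero] at this
      simp at this
    · intro w hw
      rw [Polynomial.eval_map_algebraMap]
      rcases Finset.mem_insert.1 hw with rfl | hw
      · exact hz
      · obtain ⟨u, hu, rfl⟩ := Finset.mem_image.1 hw
        rw [hf]
        simp only
        rw [haeval, hroot u (hS u hu).1 (hS u hu).2.1 (hS u hu).2.2, Complex.ofReal_zero]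
    · rw [Finset.card_insert_of_notMem hznot, Finset.card_image_of_injective _ hinj, hcard]
      exact lt_of_le_of_lt Polynomial.natDegree_map_le
        (Nat.lt_succ_of_le (natDegree_eulerFrobenius_le k))
  refine ⟨S, hcard, fun u => ⟨hS u, fun hu => ?_⟩, fun z => ⟨hall z, ?_⟩⟩
  · obtain ⟨v, hv, huv⟩ := hall ((1 - 1 / u : ℝ) : ℂ)
      (by rw [haeval, hroot u hu.1 hu.2.1 hu.2.2, Complex.ofReal_zero])
    have h1 : (1 - 1 / u : ℝ) = 1 - 1 / v := Complex.ofReal_injective huv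
    have h2 : 1 / u = 1 / v := by linarith
    have h3 : u = v := inv_injective (by simpa using h2)
    rwa [h3]
  · rintro ⟨u, hu, rfl⟩
    rw [haeval, hroot u (hS u hu).1 (hS u hu).2.1 (hS u hu).2.2, Complex.ofReal_zero]

/-- For `u` in `(0,1)`, the root `1 - 1/u` has modulus less than one exactly when `u > 1/2`, and it
increases with `u`. The symmetry `u ↦ 1 - u` makes these half of all roots. -/
theorem exists_isRootEnumeration {m : ℕ} (hm : 1 ≤ m) :
    ∃ q : Fin (m - 1) → ℝ, IsRootEnumeration m q ∧
      ∀ k, -1 < q k ∧ q k < 0 ∧ (powerSeriesPoly (2 * m - 1)).eval (1 / (1 - q k)) = 0 := by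
  obtain ⟨S, hcard, hS, hroots⟩ := exists_finset_roots (2 * m - 2)
  rw [show 2 * m - 2 + 1 = 2 * m - 1 by omega] at hS
  have hrefl : ∀ u ∈ S, 1 - u ∈ S := by
    intro u hu
    obtain ⟨h1, h2, h3⟩ := (hS u).1 hu
    refine (hS _).2 ⟨by linarith, by linarith, ?_⟩
    have := powerSeriesPoly_eval_one_sub (2 * m - 2) u
    rw [show 2 * m - 2 + 1 = 2 * m - 1 by omega, h3, mul_zero] at this
    exact this
  have hhalf : (S.filter (fun u => u < 1 / 2)).card = (S.filter (fun u => 1 / 2 < u)).card := by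
    refine Finset.card_bij (fun u _ => 1 - u) ?_ ?_ ?_
    · intro u hu
      obtain ⟨h1, h2⟩ := Finset.mem_filter.1 hu
      exact Finset.mem_filter.2 ⟨hrefl u h1, by linarith⟩
    · intro u _ v _ h; linarith
    · intro u hu
      obtain ⟨h1, h2⟩ := Finset.mem_filter.1 hu
      exact ⟨1 - u, Finset.mem_filter.2 ⟨hrefl u h1, by linarith⟩, by ring⟩
  have hcardhalf : (S.filter (fun u => 1 / 2 < u)).card = m - 1 := by
    have h1 := Finset.card_filter_add_card_filter_not (s := S) (fun u => 1 / 2 < u)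
    have h2 := Finset.card_filter_add_card_filter_not
      (s := S.filter (fun u => ¬ 1 / 2 < u)) (fun u => u < 1 / 2)
    have h3 : (S.filter (fun u => ¬ 1 / 2 < u)).filter (fun u => u < 1 / 2)
        = S.filter (fun u => u < 1 / 2) := by
      ext u
      simp only [Finset.mem_filter]
      constructor
      · rintro ⟨⟨a, b⟩, c⟩; exact ⟨a, c⟩
      · rintro ⟨a, c⟩; exact ⟨⟨a, not_lt.2 c.le⟩, c⟩
    -- Only `u = 1/2` could be left over; the parity of `2m - 2` excludes it in the final count.
    have h4 : ((S.filter (fun u => ¬ 1 / 2 < u)).filter (fun u => ¬ u < 1 / 2)).card ≤ 1 := by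
      rw [Finset.card_le_one]
      intro u hu v hv
      simp only [Finset.mem_filter, not_lt] at hu hv
      linarith [hu.1.2, hu.2, hv.1.2, hv.2]
    rw [h3, hhalf] at h2
    omega
  let e := (S.filter (fun u => 1 / 2 < u)).orderEmbOfFin hcardhalf
  have he : ∀ k, e k ∈ S ∧ 1 / 2 < e k := fun k =>
    Finset.mem_filter.1 (Finset.orderEmbOfFin_mem _ hcardhalf k)
  have he' : ∀ k, 0 < e k ∧ e k < 1 ∧ (powerSeriesPoly (2 * m - 1)).eval (e k) = 0 :=
    fun k => (hS _).1 (he k).1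
  have hq : ∀ k, -1 < 1 - 1 / e k ∧ 1 - 1 / e k < 0 := by
    intro k
    have h1 : 1 / e k < 2 := by rw [div_lt_iff₀ (he' k).1]; linarith [(he k).2]
    have h2 : 1 < 1 / e k := by rw [lt_div_iff₀ (he' k).1]; linarith [(he' k).2.1]
    constructor <;> linarith
  refine ⟨fun k => 1 - 1 / e k, ⟨?_, ?_⟩, fun k => ⟨(hq k).1, (hq k).2, ?_⟩⟩
  · intro i j hij
    have := one_div_lt_one_div_of_lt (he' i).1 (e.strictMono hij)
    simp only
    linarith
  · intro z
    rw [hroots]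
    constructor
    · rintro ⟨⟨u, hu, rfl⟩, hz⟩
      rw [Complex.norm_real, Real.norm_eq_abs] at hz
      have h0 := ((hS u).1 hu).1
      have h1 := (abs_lt.1 hz).1
      have h2 : 1 / u < 2 := by linarith
      rw [div_lt_iff₀ h0] at h2
      have h3 : u ∈ S.filter (fun u => 1 / 2 < u) := Finset.mem_filter.2 ⟨hu, by linarith⟩
      rw [← Finset.mem_coe, ← Finset.range_orderEmbOfFin _ hcardhalf] at h3
      obtain ⟨k, rfl⟩ := h3
      exact ⟨k, rfl⟩
    · rintro ⟨k, rfl⟩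
      refine ⟨⟨e k, (he k).1, rfl⟩, ?_⟩
      rw [Complex.norm_real, Real.norm_eq_abs, abs_lt]
      exact ⟨(hq k).1, by linarith [(hq k).2]⟩
  · simp only [sub_sub_cancel, one_div_one_div]
    exact (he' k).2.2

/-! ### The linear system: reformulation, unique solvability, optimality -/

section System

variable {m N : ℕ} {q d : Fin (m - 1) → ℝ}

theorem system_sum_eq {x : ℝ} (hx : x ≠ 1) (N j : ℕ) :
    ∑ i ∈ Finset.Icc 1 (j + 1), (x + (-1) ^ (i + 1) * x ^ (N + i)) / (x - 1) ^ (i + 1)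
        * diffZeroPow i (j + 1)
      = (powerSeriesPoly (j + 1)).eval (1 - 1 / (1 - x))
        + x ^ N * (powerSeriesPoly (j + 1)).eval (1 / (1 - x)) := by
  rw [powerSeriesPoly_eq_sum, Polynomial.eval_finsetSum, Polynomial.eval_finsetSum,
    Finset.mul_sum, ← Finset.sum_add_distrib, sum_Icc_one_eq_sum_range]
  refine Finset.sum_congr rfl fun i _ => ?_
  simp only [Polynomial.eval_mul, Polynomial.eval_C, Polynomial.eval_X, Polynomial.eval_pow,
    Polynomial.eval_sub, Polynomial.eval_one]
  have h1 : x - 1 ≠ 0 := sub_ne_zero.2 hx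
  have h2 : 1 - x ≠ 0 := sub_ne_zero.2 hx.symm
  have e1 : 1 - 1 / (1 - x) = x / (x - 1) := by field_simp; ring
  have e2 : x / (x - 1) - 1 = 1 / (x - 1) := by field_simp; ring
  have e3 : 1 / (1 - x) = (-1) / (x - 1) := by rw [div_eq_div_iff h2 h1]; ring
  have e4 : (-1) / (x - 1) - 1 = (-1) * x / (x - 1) := by field_simp; ring
  rw [e1, e2, e3, e4, div_pow, div_pow, mul_pow, pow_add x N, pow_succ (-1 : ℝ) (i + 1)]
  field_simp
  ring

/-- The inner sum is the expansion of `A_j` at `1 - 1/(1 - q_k)` and `1/(1 - q_k)`, with the weight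
`q_k^N` on the opposite term from `weightedEval`; reflection exchanges them at the cost of a sign.
-/
theorem system_equation_iff (hq1 : ∀ k, q k ≠ 1) {j : ℕ} (hj : 1 ≤ j) (r : ℝ) :
    ∑ k, d k * ∑ i ∈ Finset.Icc 1 j,
        (q k + (-1) ^ (i + 1) * q k ^ (N + i)) / (q k - 1) ^ (i + 1) * diffZeroPow i j = r ↔
      weightedEval N q d j = (-1) ^ (j + 1) * r := by
  obtain ⟨j, rfl⟩ : ∃ j', j = j' + 1 := ⟨j - 1, by omega⟩
  simp_rw [fun k => system_sum_eq (hq1 k) N j]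
  have h := weightedEval_reflect (N := N) (q := q) (d := d) j
  have e : ∑ k, d k * ((powerSeriesPoly (j + 1)).eval (1 - 1 / (1 - q k))
        + q k ^ N * (powerSeriesPoly (j + 1)).eval (1 / (1 - q k)))
      = (-1) ^ j * weightedEval N q d (j + 1) := by
    rw [← h]
    exact Finset.sum_congr rfl fun k _ => by ring
  rw [e]
  have h1 : ((-1 : ℝ) ^ j) * (-1) ^ j = 1 := by rw [← mul_pow]; simp
  have h2 : (-1 : ℝ) ^ (j + 1 + 1) = (-1) ^ j := by rw [pow_succ, pow_succ]; ring
  rw [h2]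
  constructor
  · rintro rfl; rw [← mul_assoc, h1, one_mul]
  · intro h3; rw [h3, ← mul_assoc, h1, one_mul]

theorem SolvesSystem.unitSystem (hq1 : ∀ k, q k ≠ 1) (hs : SolvesSystem m N q d) :
    SolvesUnitSystem m N 1 q d := by
  intro j hj1 hj
  have hmem : j ∈ Finset.Icc 1 (m - 1) := Finset.mem_Icc.2 ⟨hj1, by omega⟩
  rw [(system_equation_iff hq1 hj1 _).1 (hs j hmem),
    bernoulli_eq_bernoulli'_of_ne_one (by omega), one_mul]

theorem explicitCoeff_eq (a b : ℝ) (β : Fin (N + 1)) :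
    explicitCoeff N a b q d β = (b - a) / N * unitCoeff N 1 q d β := by
  have h : (β = 0 ∨ β = Fin.last N) ↔ ((β : ℕ) = 0 ∨ (β : ℕ) = N) := by
    simp only [Fin.ext_iff, Fin.val_zero, Fin.val_last]
  unfold explicitCoeff unitCoeff
  by_cases hβ : β = 0 ∨ β = Fin.last N
  · rw [if_pos hβ, if_pos (h.1 hβ)]
  · rw [if_neg hβ, if_neg (h.not.1 hβ)]

/-- The homogeneous system has only the trivial solution. -/
theorem eq_zero_of_homogeneous (hm : 1 ≤ m) (hN : 1 ≤ N) (hmN : m ≤ N + 1)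
    (hq : StrictMono q) (hqI : ∀ k, -1 < q k ∧ q k < 0)
    (hroot : ∀ k, (powerSeriesPoly (2 * m - 1)).eval (1 / (1 - q k)) = 0)
    (hs : SolvesUnitSystem m N 0 q d) : d = 0 := by
  have hu : ∀ k, 1 / 2 < 1 / (1 - q k) ∧ 1 / (1 - q k) < 1 := fun k => by
    have h1 : 0 < 1 - q k := by linarith [(hqI k).2]
    exact ⟨one_div_lt_one_div_of_lt h1 (by linarith [(hqI k).1]),
      by rw [div_lt_one h1]; linarith [(hqI k).2]⟩
  have hinj : ∀ k l, 1 / (1 - q k) = 1 / (1 - q l) → k = l := fun k l h => by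
    have : 1 - q k = 1 - q l := inv_injective (by simpa using h)
    exact hq.injective (by linarith)
  -- The points `1/(1 - q_k)` lie in `(1/2, 1)` and their reflections in `(0, 1/2)`: these are `2(m
  -- - 1)` distinct points, as many as the relations available.
  have hw := eq_zero_of_sum_powerSeriesPoly
    (v := Sum.elim (fun k => 1 / (1 - q k)) (fun k => 1 - 1 / (1 - q k)))
    (w := Sum.elim d (fun k => d k * q k ^ N)) ?_ ?_ ?_ ?_
  · funext k
    exact congrFun hw (Sum.inl k)
  · rintro (k | k) (l | l) h
    · exact congrArg Sum.inl (hinj k l h)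
    · simp only [Sum.elim_inl, Sum.elim_inr] at h
      linarith [(hu k).1, (hu l).1]
    · simp only [Sum.elim_inl, Sum.elim_inr] at h
      linarith [(hu k).1, (hu l).1]
    · simp only [Sum.elim_inr] at h
      exact congrArg Sum.inr (hinj k l (by linarith))
  · rintro (k | k)
    · simp only [Sum.elim_inl]; linarith [(hu k).1]
    · simp only [Sum.elim_inr]; linarith [(hu k).2]
  · rintro (k | k)
    · simp only [Sum.elim_inl]; exact (hu k).2.ne
    · simp only [Sum.elim_inr]; linarith [(hu k).1]
  · intro j hj1 hj
    simp only [Fintype.card_sum, Fintype.card_fin] at hj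
    have := weightedEval_eq_zero hm hN hmN (fun k => (hqI k).2.ne)
      (fun k => by linarith [(hqI k).2]) hroot hs hj1 (by omega)
    rw [Fintype.sum_sum_type, ← this, weightedEval, ← Finset.sum_add_distrib]
    refine Finset.sum_congr rfl fun k _ => ?_
    simp only [Sum.elim_inl, Sum.elim_inr]
    ring

theorem exists_solvesSystem (hm : 1 ≤ m) (hN : 1 ≤ N) (hmN : m ≤ N + 1)
    (hq : StrictMono q) (hqI : ∀ k, -1 < q k ∧ q k < 0)
    (hroot : ∀ k, (powerSeriesPoly (2 * m - 1)).eval (1 / (1 - q k)) = 0) :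
    ∃ d, SolvesSystem m N q d := by
  have hq1 : ∀ k, q k ≠ 1 := fun k => by linarith [(hqI k).2]
  let M : Matrix (Fin (m - 1)) (Fin (m - 1)) ℝ := fun j k =>
    ∑ i ∈ Finset.Icc 1 ((j : ℕ) + 1),
      (q k + (-1) ^ (i + 1) * q k ^ (N + i)) / (q k - 1) ^ (i + 1) * diffZeroPow i ((j : ℕ) + 1)
  have hM : ∀ d j, Matrix.mulVecLin M d j = ∑ k, d k * ∑ i ∈ Finset.Icc 1 ((j : ℕ) + 1),
      (q k + (-1) ^ (i + 1) * q k ^ (N + i)) / (q k - 1) ^ (i + 1)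
        * diffZeroPow i ((j : ℕ) + 1) := by
    intro d j
    rw [Matrix.mulVecLin_apply, Matrix.mulVec, dotProduct]
    exact Finset.sum_congr rfl fun k _ => mul_comm (M j k) (d k)
  -- The system is square, so triviality of the kernel gives existence.
  have hinj : Function.Injective (Matrix.mulVecLin M) := by
    rw [← LinearMap.ker_eq_bot, LinearMap.ker_eq_bot']
    intro d hd
    refine eq_zero_of_homogeneous hm hN hmN hq hqI hroot fun j hj1 hj => ?_
    obtain ⟨j, rfl⟩ : ∃ j', j = j' + 1 := ⟨j - 1, by omega⟩
    have h1 := congrFun hd ⟨j, by omega⟩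
    rw [hM] at h1
    rw [(system_equation_iff hq1 hj1 0).1 h1]
    simp
  obtain ⟨d, hd⟩ := (LinearMap.injective_iff_surjective.1 hinj)
    (fun j => ((bernoulli ((j : ℕ) + 1 + 1) : ℚ) : ℝ) / (((j : ℕ) + 1 : ℕ) + 1))
  refine ⟨d, fun j hj => ?_⟩
  obtain ⟨hj1, hj2⟩ := Finset.mem_Icc.1 hj
  obtain ⟨j, rfl⟩ : ∃ j', j = j' + 1 := ⟨j - 1, by omega⟩
  have h1 := congrFun hd ⟨j, by omega⟩
  rw [hM] at h1
  exact h1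

theorem isSardOptimal_iff_explicitCoeff (hm : 1 ≤ m) (hN : 1 ≤ N) {a b : ℝ} (hab : a < b)
    (hq0 : ∀ k, q k ≠ 0) (hq1 : ∀ k, q k ≠ 1)
    (hroot : ∀ k, (powerSeriesPoly (2 * m - 1)).eval (1 / (1 - q k)) = 0)
    (hs : SolvesSystem m N q d) (C : Fin (N + 1) → ℂ) :
    IsSardOptimal m a b C ↔ ∀ β, C β = ((explicitCoeff N a b q d β : ℝ) : ℂ) := by
  have hN0 : (0 : ℝ) < N := by exact_mod_cast hN
  have hh : 0 < (b - a) / N := div_pos (sub_pos.2 hab) hN0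
  have hs' := hs.unitSystem hq1
  simp_rw [explicitCoeff_eq]
  refine isSardOptimal_iff hm hN hab
    (C := fun β : Fin (N + 1) => (b - a) / N * unitCoeff N 1 q d β)
    (x := fun β : Fin (N + 1) => (b - a) / N * (β : ℝ) + a)
    (iterate_derivative_scaledPoly (N := N) (κ := 1) (q := q) (d := d) hm ((b - a) / N) a)
    (fun _ => rfl) (fun j hj => ?_) (spline_vanish hm hq0 hq1 hroot hs' hh) C
  have h1 := moment_scaled hN hq0 hq1 hs' ((b - a) / N) a hj
  rwa [one_mul, div_mul_cancel₀ _ hN0.ne', sub_add_cancel] at h1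

end System

end SardQuadrature

theorem theorem8 (m N : ℕ) (hm : 1 ≤ m) (hN : 1 ≤ N) (hmN : m ≤ N + 1)
    (a b : ℝ) (hab : a < b) :
    ∃ q : Fin (m - 1) → ℝ, SardQuadrature.IsRootEnumeration m q ∧
      (∃ d : Fin (m - 1) → ℝ, SardQuadrature.SolvesSystem m N q d) ∧
      ∀ d : Fin (m - 1) → ℝ, SardQuadrature.SolvesSystem m N q d →
        ∀ C : Fin (N + 1) → ℂ,
          SardQuadrature.IsSardOptimal m a b C ↔
            ∀ β : Fin (N + 1), C β = ((SardQuadrature.explicitCoeff N a b q d β : ℝ) : ℂ) := by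
  obtain ⟨q, hq, hqI⟩ := SardQuadrature.exists_isRootEnumeration hm
  refine ⟨q, hq, SardQuadrature.exists_solvesSystem hm hN hmN hq.1
    (fun k => ⟨(hqI k).1, (hqI k).2.1⟩) fun k => (hqI k).2.2, fun d hd C => ?_⟩
  exact SardQuadrature.isSardOptimal_iff_explicitCoeff hm hN hab (fun k => (hqI k).2.1.ne)
    (fun k => by linarith [(hqI k).2.1]) (fun k => (hqI k).2.2) hd C
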